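/- Let $\mathcal H,\mathcal K_1,\mathcal K_2$ be complex Hilbert spaces. For $j=1,2$ let $L_j$ be a (possibly unbounded) self-adjoint operator in $\mathcal K_j$ that is bounded from below, let $K_j\in\mathcal B_4(\mathcal K_j,\mathcal H)$ (the Schatten class of bounded operators $K$ with $\operatorname{tr}\big((K^*K)^2\big)<\infty$), and set $$M_j(z)=K_j(L_j-z)^{-1}K_j^*,\qquad z\in\mathbb C\setminus\operatorname{spec}(L_j).$$ Let $\mathcal D\subset\mathbb C$ be a domain (a non-empty open connected set) and $(a,b)\subset\mathbb R$, $a<b$, a bounded open interval such that $$a<\min_{j=1,2}\inf\operatorname{spec}(L_j)\qquad\text{and}\qquad\big(\operatorname{spec}(L_1)\cup\operatorname{spec}(L_2)\big)\cap\mathcal D\subset(a,b)\subset\mathcal D$$ (with $\inf\emptyset=+\infty$). Let $\Gamma$ be a closed (piecewise $C^1$) Jordan contour which, together with its interior, is contained in $\mathcal D$, and which encircles $[a,b]$ in the clockwise direction, that is, $\Gamma$ does not meet $[a,b]$ and has winding number $-1$ about every point of $[a,b]$. Let $\varphi$ be an analytic function on $\mathcal D$ that is real-valued on $(a,b)$ with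 $\varphi\ge 0$ and $\varphi'\le 0$ on $(a,b)$. Then $M_1(z)M_2(z)$ is a trace class operator on $\mathcal H$ for every $z\in\Gamma$, the function $z\mapsto\varphi(z)\operatorname{tr}\big(M_1(z)M_2(z)\big)$ is integrable along $\Gamma$, and $$\frac1{2\pi i}\oint_\Gamma\varphi(z)\,\operatorname{tr}\big(M_1(z)M_2(z)\big)\,dz\ \ge\ 0$$ (in particular the left-hand side is real). -/

import Mathlib

open scoped ComplexOrder

noncomputable section

namespace HerglotzTrace

/-! ### Unbounded operators: resolvent and spectrum -/

section Operators

variable {E : Type*} [NormedAddCommGroup E] [InnerProductSpace ℂ E]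

/-- `R` is a bounded, everywhere defined, two-sided inverse of `L - z : dom L → E`. -/
def IsResolventAt (L : E →ₗ.[ℂ] E) (z : ℂ) (R : E →L[ℂ] E) : Prop :=
  (∀ x : E, ∃ h : R x ∈ L.domain, L ⟨R x, h⟩ - z • R x = x) ∧
    ∀ y : L.domain, R (L y - z • (y : E)) = y

/-- The spectrum of a (possibly unbounded) operator: the complement of its resolvent set. -/
def spec (L : E →ₗ.[ℂ] E) : Set ℂ := {z | ¬ ∃ R : E →L[ℂ] E, IsResolventAt L z R}

open Classical in
/-- The resolvent `(L - z)⁻¹` (by convention `0` when `z` lies in the spectrum). -/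
def resolventOp (L : E →ₗ.[ℂ] E) (z : ℂ) : E →L[ℂ] E :=
  if h : ∃ R : E →L[ℂ] E, IsResolventAt L z R then h.choose else 0

/-- The infimum of (the real parts of) the spectrum, `+∞` if the spectrum is empty. -/
def specInf (L : E →ₗ.[ℂ] E) : EReal := ⨅ w ∈ spec L, ((w.re : ℝ) : EReal)

/-- `L` is bounded from below: `⟨x, L x⟩ ≥ c ‖x‖²` on the domain, for some real `c`. -/
def BoundedFromBelow (L : E →ₗ.[ℂ] E) : Prop :=
  ∃ c : ℝ, ∀ x : L.domain, c * ‖(x : E)‖ ^ 2 ≤ (inner ℂ (x : E) (L x)).re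

end Operators

/-! ### Trace and Schatten classes -/

section Schatten

/-- The index set of a fixed orthonormal (Hilbert) basis of `E`. -/
def basisIndex (E : Type*) [NormedAddCommGroup E] [InnerProductSpace ℂ E] [CompleteSpace E] :
    Set E := (exists_hilbertBasis ℂ E).choose

/-- A fixed orthonormal (Hilbert) basis of `E`. Neither membership in a Schatten class nor the
trace of a trace class operator depends on it. -/
def onb (E : Type*) [NormedAddCommGroup E] [InnerProductSpace ℂ E] [CompleteSpace E] :
    HilbertBasis (basisIndex E) ℂ E := (exists_hilbertBasis ℂ E).choose_spec.choose

variable {E F : Type*} [NormedAddCommGroup E] [InnerProductSpace ℂ E] [CompleteSpace E]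
  [NormedAddCommGroup F] [InnerProductSpace ℂ F] [CompleteSpace F]

/-- `|T|^p = (T* T)^(p/2)`, by the continuous functional calculus. -/
def absPow (p : ℝ) (T : E →L[ℂ] F) : E →L[ℂ] E :=
  (ContinuousLinearMap.adjoint T ∘L T) ^ (p / 2)

/-- `T` belongs to the Schatten class `B_p(E, F)`, `0 < p < ∞`: `tr (|T|^p) < ∞`. -/
def IsSchatten (p : ℝ) (T : E →L[ℂ] F) : Prop :=
  Summable fun i : basisIndex E => (inner ℂ (onb E i) (absPow p T (onb E i))).re

/-- The trace `∑ᵢ ⟨eᵢ, T eᵢ⟩` (meaningful for `T` in the trace class `B_1`). -/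
def trace (T : E →L[ℂ] E) : ℂ :=
  ∑' i : basisIndex E, inner ℂ (onb E i) (T (onb E i))

/-- The function `M(z) = K (L - z)⁻¹ K*`. -/
def herglotz (K : E →L[ℂ] F) (L : E →ₗ.[ℂ] E) (z : ℂ) : F →L[ℂ] F :=
  K ∘L resolventOp L z ∘L ContinuousLinearMap.adjoint K

end Schatten

/-! ### Contours in the complex plane, parametrized by `[0, 1]` -/

/-- `γ` is piecewise continuously differentiable on `[0, 1]`. -/
def PiecewiseC1 (γ : ℝ → ℂ) : Prop :=
  ∃ (n : ℕ) (t : ℕ → ℝ), Monotone t ∧ t 0 = 0 ∧ t n = 1 ∧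
    ∀ i < n, ContDiffOn ℝ 1 γ (Set.Icc (t i) (t (i + 1)))

/-- A closed Jordan contour: a simple closed piecewise `C¹` curve. -/
structure IsJordanContour (γ : ℝ → ℂ) : Prop where
  piecewiseC1 : PiecewiseC1 γ
  closed : γ 0 = γ 1
  simple : Set.InjOn γ (Set.Ico 0 1)

/-- The image of the curve. -/
def contourImage (γ : ℝ → ℂ) : Set ℂ := γ '' Set.Icc 0 1

/-- The contour integral `∮_γ f(z) dz`. -/
def contourIntegral (f : ℂ → ℂ) (γ : ℝ → ℂ) : ℂ :=
  ∫ t in (0 : ℝ)..1, f (γ t) * deriv γ t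

/-- Integrability of the integrand of `∮_γ f(z) dz`. -/
def ContourIntegrable (f : ℂ → ℂ) (γ : ℝ → ℂ) : Prop :=
  IntervalIntegrable (fun t => f (γ t) * deriv γ t) MeasureTheory.volume 0 1

/-- The winding number `(1 / 2πi) ∮_γ dz / (z - w)`, for `w` off the curve. -/
def windingNumber (γ : ℝ → ℂ) (w : ℂ) : ℂ :=
  (2 * Real.pi * Complex.I)⁻¹ * contourIntegral (fun z => (z - w)⁻¹) γ

/-- The points enclosed by the contour: those off the curve with nonzero winding number. -/
def contourInterior (γ : ℝ → ℂ) : Set ℂ :=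
  {w | w ∉ contourImage γ ∧ windingNumber γ w ≠ 0}

/-- The contour encircles the set `S` once in the clockwise direction. -/
def EncirclesClockwise (γ : ℝ → ℂ) (S : Set ℂ) : Prop :=
  ∀ w ∈ S, w ∉ contourImage γ ∧ windingNumber γ w = -1

end HerglotzTrace

end

/-! ### Piecewise `C¹` contours -/

namespace HerglotzTrace

section Contours

open Set Filter MeasureTheory Topology

variable {γ : ℝ → ℂ}

theorem PiecewiseC1.continuousOn (h : PiecewiseC1 γ) : ContinuousOn γ (Icc 0 1) := by
  obtain ⟨n, t, ht, h0, h1, hc⟩ := h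
  have key : ∀ i ≤ n, ContinuousOn γ (Icc (t 0) (t i)) := by
    intro i
    induction i with
    | zero => intro _; simp
    | succ i ih =>
      intro hi
      rw [← Icc_union_Icc_eq_Icc (ht (Nat.zero_le i)) (ht i.le_succ)]
      exact (ih (by omega)).union_of_isClosed (hc i (by omega)).continuousOn isClosed_Icc
        isClosed_Icc
  simpa [h0, h1] using key n le_rfl

theorem PiecewiseC1.intervalIntegrable_deriv (h : PiecewiseC1 γ) :
    IntervalIntegrable (deriv γ) volume 0 1 := by
  obtain ⟨n, t, ht, h0, h1, hc⟩ := h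
  rw [← h0, ← h1]
  refine IntervalIntegrable.trans_iterate fun k hk => ?_
  rcases (ht k.le_succ).eq_or_lt with he | hlt
  · rw [Nat.succ_eq_add_one] at he
    rw [he]
  · have hd := (hc k hk).continuousOn_derivWithin (uniqueDiffOn_Icc hlt) le_rfl
    rw [← uIcc_of_le hlt.le] at hd
    refine hd.intervalIntegrable.congr_uIoo fun x hx => ?_
    rw [uIoo_of_le hlt.le] at hx
    rw [uIcc_of_le hlt.le]
    exact derivWithin_of_mem_nhds (Icc_mem_nhds hx.1 hx.2)

theorem PiecewiseC1.exists_countable_hasDerivAt (h : PiecewiseC1 γ) :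
    ∃ s : Set ℝ, s.Countable ∧ ∀ x ∈ Ioo (0 : ℝ) 1 \ s, HasDerivAt γ (deriv γ x) x := by
  obtain ⟨n, t, ht, h0, h1, hc⟩ := h
  refine ⟨range t, countable_range t, fun x hx => ?_⟩
  classical
  have hex : ∃ k, x < t k := ⟨n, by rw [h1]; exact hx.1.2⟩
  obtain ⟨k, hk⟩ : ∃ k, Nat.find hex = k + 1 := by
    refine Nat.exists_eq_succ_of_ne_zero fun h => ?_
    have := Nat.find_spec hex
    rw [h, h0] at this
    exact absurd this (not_lt.2 hx.1.1.le)
  have hlt : x < t (k + 1) := hk ▸ Nat.find_spec hex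
  have hkn : k < n := by
    have : Nat.find hex ≤ n := Nat.find_min' hex (by rw [h1]; exact hx.1.2)
    omega
  have hle : t k ≤ x := not_lt.1 (Nat.find_min hex (by omega))
  have hlt' : t k < x := lt_of_le_of_ne hle fun he => hx.2 ⟨k, he⟩
  exact ((((hc k hkn).differentiableOn one_ne_zero) x ⟨hle, hlt.le⟩).differentiableAt
    (Icc_mem_nhds hlt' hlt)).hasDerivAt

theorem PiecewiseC1.isCompact_contourImage (h : PiecewiseC1 γ) : IsCompact (contourImage γ) :=
  isCompact_Icc.image_of_continuousOn h.continuousOn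

theorem PiecewiseC1.contourIntegrable (h : PiecewiseC1 γ) {f : ℂ → ℂ}
    (hf : ContinuousOn f (contourImage γ)) : ContourIntegrable f γ := by
  refine h.intervalIntegrable_deriv.continuousOn_mul ?_
  rw [uIcc_of_le zero_le_one]
  exact hf.comp h.continuousOn (mapsTo_image _ _)

/-- The integral of a derivative along a closed contour vanishes. -/
theorem PiecewiseC1.contourIntegral_of_hasDerivAt (h : PiecewiseC1 γ) (hcl : γ 0 = γ 1)
    {f g : ℂ → ℂ} (hf : ∀ z ∈ contourImage γ, HasDerivAt f (g z) z)
    (hg : ContinuousOn g (contourImage γ)) : contourIntegral g γ = 0 := by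
  obtain ⟨s, hs, hd⟩ := h.exists_countable_hasDerivAt
  have hfc : ContinuousOn f (contourImage γ) := fun z hz =>
    (hf z hz).continuousAt.continuousWithinAt
  have := integral_eq_of_hasDerivAt_off_countable_of_le (fun t => f (γ t))
    (fun t => g (γ t) * deriv γ t) zero_le_one hs
    (hfc.comp h.continuousOn (mapsTo_image _ _))
    (fun x hx => (hf _ (mem_image_of_mem γ (Ioo_subset_Icc_self hx.1))).comp_of_eq x (hd x hx) rfl)
    (h.contourIntegrable hg)
  rw [contourIntegral, this, hcl, sub_self]

/-- Differentiation under the integral sign for an integrand that is jointly continuous and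
holomorphic in the parameter. -/
theorem hasDerivAt_intervalIntegral_mul {G : ℂ → ℝ → ℂ} {U : Set ℂ} (hU : IsOpen U) {k : ℝ → ℂ}
    (hG : ContinuousOn (fun p : ℂ × ℝ => G p.1 p.2) (U ×ˢ Icc 0 1))
    (hd : ∀ t ∈ Icc (0 : ℝ) 1, DifferentiableOn ℂ (fun w => G w t) U)
    (hk : IntervalIntegrable k volume 0 1) {w : ℂ} (hw : w ∈ U) :
    HasDerivAt (fun w => ∫ t in (0 : ℝ)..1, G w t * k t)
      (∫ t in (0 : ℝ)..1, deriv (fun w => G w t) w * k t) w := by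
  obtain ⟨r, hr, hrU⟩ : ∃ r > 0, Metric.closedBall w (r + r) ⊆ U := by
    obtain ⟨ε, hε, h⟩ := Metric.nhds_basis_closedBall.mem_iff.1 (hU.mem_nhds hw)
    exact ⟨ε / 2, by positivity, by simpa using h⟩
  obtain ⟨C, hC⟩ := ((isCompact_closedBall w (r + r)).prod
    (isCompact_Icc (a := (0 : ℝ)) (b := 1))).exists_bound_of_continuousOn
    (hG.mono (prod_mono hrU Subset.rfl))
  have hslice : ∀ x ∈ U, ContinuousOn (fun t => G x t) (Icc 0 1) := fun x hx =>
    hG.comp (f := fun t : ℝ => (x, t)) (by fun_prop) fun t ht => ⟨hx, ht⟩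
  have hmeasG : ∀ x ∈ U, AEStronglyMeasurable (fun t => G x t) (volume.restrict (uIoc 0 1)) := by
    intro x hx
    rw [uIoc_of_le zero_le_one]
    exact ((hslice x hx).mono Ioc_subset_Icc_self).aestronglyMeasurable measurableSet_Ioc
  have hmeask : AEStronglyMeasurable k (volume.restrict (uIoc 0 1)) := by
    rw [uIoc_of_le zero_le_one]; exact hk.1.aestronglyMeasurable
  refine (intervalIntegral.hasDerivAt_integral_of_dominated_loc_of_deriv_le
    (F' := fun x t => deriv (fun w => G w t) x * k t) (bound := fun t => C / r * ‖k t‖)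
    (Metric.ball_mem_nhds w hr) ?_ ?_ ?_ ?_ ?_ ?_).2
  · filter_upwards [hU.mem_nhds hw] with x hx
    exact (hmeasG x hx).mul hmeask
  · refine hk.continuousOn_mul ?_
    rw [uIcc_of_le zero_le_one]
    exact hslice w hw
  · refine AEStronglyMeasurable.mul ?_ hmeask
    have hmem : ∀ n : ℕ, w + (r / (n + 1) : ℝ) ∈ U := by
      intro n
      apply hrU
      have h1 : 0 < r / (n + 1) := by positivity
      have h2 : r / (n + 1) ≤ r := div_le_self hr.le (by linarith [n.cast_nonneg (α := ℝ)])
      simp only [Metric.mem_closedBall, dist_self_add_left, Complex.norm_real, Real.norm_eq_abs]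
      rw [abs_of_pos h1]; linarith
    have hlim : Tendsto (fun n : ℕ => w + ((r / (n + 1) : ℝ) : ℂ)) atTop (𝓝[≠] w) := by
      refine tendsto_nhdsWithin_iff.2 ⟨?_, ?_⟩
      · have h1 : Tendsto (fun n : ℕ => r / ((n : ℝ) + 1)) atTop (𝓝 0) := by
          simpa [div_eq_mul_inv] using tendsto_one_div_add_atTop_nhds_zero_nat.const_mul r
        have h2 := (Complex.continuous_ofReal.tendsto 0).comp h1
        simpa using tendsto_const_nhds (x := w).add h2
      · refine Eventually.of_forall fun n => ?_
        have h1 : 0 < r / ((n : ℝ) + 1) := by positivity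
        simp only [mem_compl_iff, mem_singleton_iff, add_eq_left]
        exact_mod_cast h1.ne'
    refine aestronglyMeasurable_of_tendsto_ae atTop
      (f := fun (n : ℕ) t => slope (fun w => G w t) w (w + ((r / (n + 1) : ℝ) : ℂ)))
      (fun n => ?_) ?_
    · simp only [slope_def_field]
      simp only [div_eq_mul_inv]
      exact ((hmeasG _ (by simpa [div_eq_mul_inv] using hmem n)).sub (hmeasG _ hw)).mul_const _
    · refine (ae_restrict_mem measurableSet_uIoc).mono fun t ht => ?_
      rw [uIoc_of_le zero_le_one] at ht
      exact ((hd t (Ioc_subset_Icc_self ht)).differentiableAt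
        (hU.mem_nhds hw)).hasDerivAt.tendsto_slope.comp hlim
  · refine Eventually.of_forall fun t ht x hx => ?_
    rw [uIoc_of_le zero_le_one] at ht
    have hsub : Metric.closedBall x r ⊆ Metric.closedBall w (r + r) :=
      Metric.closedBall_subset_closedBall' (by linarith [Metric.mem_ball.1 hx])
    rw [norm_mul]
    refine mul_le_mul_of_nonneg_right ?_ (norm_nonneg _)
    refine Complex.norm_deriv_le_of_forall_mem_sphere_norm_le hr ?_ fun z hz =>
      hC (z, t) ⟨hsub (Metric.sphere_subset_closedBall hz), Ioc_subset_Icc_self ht⟩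
    refine DifferentiableOn.diffContOnCl ?_
    rw [closure_ball _ hr.ne']
    exact (hd t (Ioc_subset_Icc_self ht)).mono (hsub.trans hrU)
  · exact hk.norm.const_mul _
  · refine Eventually.of_forall fun t ht x hx => ?_
    rw [uIoc_of_le zero_le_one] at ht
    have hxU : x ∈ U := hrU (Metric.closedBall_subset_closedBall (by linarith)
      (Metric.ball_subset_closedBall hx))
    exact (((hd t (Ioc_subset_Icc_self ht)).differentiableAt
      (hU.mem_nhds hxU)).hasDerivAt).mul_const _

/-- The Cauchy transform along a contour is holomorphic off the contour. -/
theorem PiecewiseC1.hasDerivAt_cauchyTransform (h : PiecewiseC1 γ) {f : ℂ → ℂ}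
    (hf : ContinuousOn f (contourImage γ)) {w : ℂ} (hw : w ∉ contourImage γ) :
    HasDerivAt (fun w => contourIntegral (fun z => f z * (z - w)⁻¹) γ)
      (contourIntegral (fun z => f z * ((z - w) ^ 2)⁻¹) γ) w := by
  have hne : ∀ x ∈ (contourImage γ)ᶜ, ∀ t ∈ Icc (0 : ℝ) 1, γ t - x ≠ 0 := fun x hx t ht h0 =>
    hx ⟨t, ht, sub_eq_zero.1 h0⟩
  have hder : ∀ x ∈ (contourImage γ)ᶜ, ∀ t ∈ Icc (0 : ℝ) 1,
      HasDerivAt (fun w => f (γ t) * (γ t - w)⁻¹) (f (γ t) * ((γ t - x) ^ 2)⁻¹) x := by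
    intro x hx t ht
    have := ((((hasDerivAt_id x).const_sub (γ t)).inv (hne x hx t ht)).const_mul (f (γ t)))
    simpa [div_eq_mul_inv] using this
  have hfγ : ContinuousOn (fun t => f (γ t)) (Icc 0 1) := hf.comp h.continuousOn (mapsTo_image _ _)
  have key := hasDerivAt_intervalIntegral_mul (G := fun w t => f (γ t) * (γ t - w)⁻¹)
    h.isCompact_contourImage.isClosed.isOpen_compl ?_ ?_ h.intervalIntegrable_deriv hw
  · have e : contourIntegral (fun z => f z * ((z - w) ^ 2)⁻¹) γ
        = ∫ t in (0 : ℝ)..1, deriv (fun w => f (γ t) * (γ t - w)⁻¹) w * deriv γ t := by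
      refine intervalIntegral.integral_congr (μ := volume) fun t ht => ?_
      rw [uIcc_of_le zero_le_one] at ht
      simp only [(hder w hw t ht).deriv]
    rw [e]
    exact key
  · refine ContinuousOn.mul (hfγ.comp continuousOn_snd fun p hp => hp.2) (ContinuousOn.inv₀
      ((h.continuousOn.comp continuousOn_snd fun p hp => hp.2).sub continuousOn_fst)
      fun p hp => hne p.1 hp.1 p.2 hp.2)
  · exact fun t ht x hx => (hder x hx t ht).differentiableAt.differentiableWithinAt

theorem PiecewiseC1.tendsto_cauchyTransform_cocompact (h : PiecewiseC1 γ) {f : ℂ → ℂ}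
    (hf : ContinuousOn f (contourImage γ)) :
    Tendsto (fun w => contourIntegral (fun z => f z * (z - w)⁻¹) γ) (cocompact ℂ) (𝓝 0) := by
  obtain ⟨R, hR⟩ := h.isCompact_contourImage.exists_bound_of_continuousOn continuousOn_id
  obtain ⟨C, hC⟩ := h.isCompact_contourImage.exists_bound_of_continuousOn hf
  set J : ℝ := ∫ t in (0 : ℝ)..1, C * ‖deriv γ t‖
  have hlim : Tendsto (fun w : ℂ => (‖w‖ - R)⁻¹ * J) (cocompact ℂ) (𝓝 0) := by
    have : Tendsto (fun w : ℂ => ‖w‖ - R) (cocompact ℂ) atTop :=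
      tendsto_atTop_add_const_right _ _ (tendsto_norm_cocompact_atTop)
    simpa using (tendsto_inv_atTop_zero.comp this).mul_const J
  refine squeeze_zero_norm' ?_ hlim
  filter_upwards [tendsto_norm_cocompact_atTop.eventually (eventually_gt_atTop R)] with w hw
  rw [contourIntegral, ← intervalIntegral.integral_const_mul]
  refine intervalIntegral.norm_integral_le_of_norm_le zero_le_one
    (Eventually.of_forall fun t ht => ?_)
    ((h.intervalIntegrable_deriv.norm.const_mul C).const_mul _)
  have htm : γ t ∈ contourImage γ := mem_image_of_mem γ (Ioc_subset_Icc_self ht)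
  have h1 : ‖γ t‖ ≤ R := hR _ htm
  have h2 : ‖w‖ - R ≤ ‖γ t - w‖ := by
    have := norm_sub_norm_le w (γ t)
    rw [norm_sub_rev] at this
    linarith
  have h3 : 0 < ‖w‖ - R := sub_pos.2 hw
  rw [norm_mul, norm_mul, norm_inv]
  calc ‖f (γ t)‖ * ‖γ t - w‖⁻¹ * ‖deriv γ t‖
      ≤ C * (‖w‖ - R)⁻¹ * ‖deriv γ t‖ := by
        gcongr
        · exact (norm_nonneg _).trans (hC _ htm)
        · exact hC _ htm
    _ = (‖w‖ - R)⁻¹ * (C * ‖deriv γ t‖) := by ring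

theorem PiecewiseC1.hasDerivAt_windingNumber (h : PiecewiseC1 γ) (hcl : γ 0 = γ 1) {w : ℂ}
    (hw : w ∉ contourImage γ) : HasDerivAt (windingNumber γ) 0 w := by
  have h1 := (h.hasDerivAt_cauchyTransform (f := fun _ => 1) continuousOn_const hw).const_mul
    ((2 * Real.pi * Complex.I)⁻¹ : ℂ)
  have hne : ∀ z ∈ contourImage γ, z - w ≠ 0 := fun z hz h0 => hw (sub_eq_zero.1 h0 ▸ hz)
  have h2 : contourIntegral (fun z => (1 : ℂ) * ((z - w) ^ 2)⁻¹) γ = 0 := by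
    refine h.contourIntegral_of_hasDerivAt hcl (f := fun z => -(z - w)⁻¹) (fun z hz => ?_) ?_
    · have := (((hasDerivAt_id z).sub_const w).inv (hne z hz)).neg
      rw [one_mul, inv_eq_one_div, ← neg_neg (1 / _), neg_div']
      exact this
    · exact continuousOn_const.mul (ContinuousOn.inv₀ (by fun_prop)
        fun z hz => pow_ne_zero 2 (hne z hz))
  rw [h2, mul_zero] at h1
  simp only [one_mul] at h1
  exact h1

theorem PiecewiseC1.windingNumber_eq_of_isPreconnected (h : PiecewiseC1 γ) (hcl : γ 0 = γ 1)
    {s : Set ℂ} (hs : IsOpen s) (hsc : IsPreconnected s) (hd : Disjoint s (contourImage γ))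
    {v w : ℂ} (hv : v ∈ s) (hw : w ∈ s) : windingNumber γ v = windingNumber γ w := by
  have hder : ∀ x ∈ s, HasDerivAt (windingNumber γ) 0 x := fun x hx =>
    h.hasDerivAt_windingNumber hcl (disjoint_left.1 hd hx)
  exact hs.is_const_of_deriv_eq_zero hsc
    (fun x hx => (hder x hx).differentiableAt.differentiableWithinAt)
    (fun x hx => (hder x hx).deriv) hv hw

theorem PiecewiseC1.eventually_windingNumber_eq_zero (h : PiecewiseC1 γ) (hcl : γ 0 = γ 1) :
    ∀ᶠ w in cocompact ℂ, w ∉ contourImage γ ∧ windingNumber γ w = 0 := by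
  obtain ⟨R, hR⟩ := h.isCompact_contourImage.exists_bound_of_continuousOn continuousOn_id
  filter_upwards [tendsto_norm_cocompact_atTop.eventually (eventually_gt_atTop (max R 0))] with w hw
  have hw0 : 0 < ‖w‖ := (le_max_right _ _).trans_lt hw
  have hwR : R < ‖w‖ := (le_max_left _ _).trans_lt hw
  set s : Set ℂ := {v | ‖w‖ * R < inner ℝ w v} with hs
  have hso : IsOpen s := isOpen_lt continuous_const (by fun_prop)
  have hsc : IsPreconnected s :=
    (convex_halfSpace_gt (innerₗ ℂ w).isLinear _).isPreconnected
  have hd : Disjoint s (contourImage γ) := disjoint_left.2 fun z hz hz' =>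
    absurd ((real_inner_le_norm w z).trans (mul_le_mul_of_nonneg_left (hR z hz') hw0.le))
      (not_le.2 hz)
  have hmem : ∀ c : ℝ, 1 ≤ c → (c : ℂ) * w ∈ s := by
    intro c hc
    rw [hs, mem_ofPred_eq, ← Complex.real_smul, inner_smul_right, real_inner_self_eq_norm_mul_norm]
    calc ‖w‖ * R < ‖w‖ * ‖w‖ := by gcongr
      _ ≤ c * (‖w‖ * ‖w‖) := le_mul_of_one_le_left (by positivity) hc
  have hws : w ∈ s := by simpa using hmem 1 le_rfl
  refine ⟨disjoint_left.1 hd hws, ?_⟩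
  have hray : Tendsto (fun c : ℝ => (c : ℂ) * w) atTop (cocompact ℂ) := by
    rw [← Metric.cobounded_eq_cocompact, ← tendsto_norm_atTop_iff_cobounded]
    simp only [norm_mul, Complex.norm_real]
    exact tendsto_norm_atTop_atTop.atTop_mul_const hw0
  have hlim : Tendsto (fun c : ℝ => windingNumber γ ((c : ℂ) * w)) atTop (𝓝 0) := by
    have := ((h.tendsto_cauchyTransform_cocompact (f := fun _ => 1) continuousOn_const).comp
      hray).const_mul ((2 * Real.pi * Complex.I)⁻¹ : ℂ)
    simpa [windingNumber, Function.comp_def] using this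
  refine tendsto_nhds_unique (tendsto_const_nhds.congr' ?_) hlim
  filter_upwards [eventually_ge_atTop 1] with c hc
  exact h.windingNumber_eq_of_isPreconnected hcl hso hsc hd hws (hmem c hc)

/-- The difference quotient of a holomorphic function is jointly continuous. -/
theorem continuousOn_dslope_prod {f : ℂ → ℂ} {D : Set ℂ} (hD : IsOpen D)
    (hf : DifferentiableOn ℂ f D) :
    ContinuousOn (fun p : ℂ × ℂ => dslope f p.1 p.2) (D ×ˢ D) := by
  rintro ⟨z, w⟩ ⟨hz, hw⟩
  simp only at hz hw
  refine ContinuousAt.continuousWithinAt ?_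
  have hfc : ∀ x ∈ D, ContinuousAt f x := fun x hx =>
    (hf.differentiableAt (hD.mem_nhds hx)).continuousAt
  by_cases hzw : w = z
  · subst hzw
    have han : AnalyticAt ℂ f w := hf.analyticAt (hD.mem_nhds hw)
    have hst := han.hasStrictDerivAt
    rw [Metric.continuousAt_iff']
    intro ε hε
    have h1 := (hasStrictDerivAt_iff_hasStrictFDerivAt.1 hst).isLittleO.def (half_pos hε)
    have h2 : ∀ᶠ p : ℂ × ℂ in 𝓝 (w, w), dist (deriv f p.1) (deriv f w) < ε :=
      (han.deriv.continuousAt.comp' continuousAt_fst).eventually (Metric.ball_mem_nhds _ hε)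
    filter_upwards [h1, h2] with p hp1 hp2
    rw [dslope_same]
    by_cases hp : p.2 = p.1
    · rw [hp, dslope_same]; exact hp2
    · have hne : p.1 - p.2 ≠ 0 := sub_ne_zero.2 (Ne.symm hp)
      have e : dslope f p.1 p.2 - deriv f w
          = (f p.1 - f p.2 - (p.1 - p.2) * deriv f w) / (p.1 - p.2) := by
        rw [dslope_of_ne _ hp, slope_def_field, eq_div_iff hne]
        have : p.2 - p.1 ≠ 0 := sub_ne_zero.2 hp
        field_simp
        ring
      rw [dist_eq_norm, e, norm_div, div_lt_iff₀ (norm_pos_iff.2 hne)]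
      refine lt_of_le_of_lt (by simpa using hp1) ?_
      gcongr
      linarith
  · have : (fun p : ℂ × ℂ => dslope f p.1 p.2) =ᶠ[𝓝 (z, w)]
        fun p => (f p.2 - f p.1) / (p.2 - p.1) := by
      have ho : IsOpen {p : ℂ × ℂ | p.2 ≠ p.1} := isOpen_ne_fun continuous_snd continuous_fst
      filter_upwards [ho.mem_nhds (show (z, w) ∈ {p : ℂ × ℂ | p.2 ≠ p.1} from hzw)] with p hp
      rw [dslope_of_ne _ hp, slope_def_field]
    refine ContinuousAt.congr ?_ this.symm
    exact ((((hfc w hw).comp' continuousAt_snd).sub ((hfc z hz).comp' continuousAt_fst)).div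
      (continuousAt_snd.sub continuousAt_fst) (sub_ne_zero.2 hzw))

theorem PiecewiseC1.differentiableAt_contourIntegral_dslope (h : PiecewiseC1 γ) {D : Set ℂ}
    (hD : IsOpen D) (hγD : contourImage γ ⊆ D) {f : ℂ → ℂ} (hf : DifferentiableOn ℂ f D) {v : ℂ}
    (hv : v ∈ D) : DifferentiableAt ℂ (fun w => contourIntegral (fun z => dslope f z w) γ) v := by
  have hγm : ∀ t ∈ Icc (0 : ℝ) 1, γ t ∈ D := fun t ht => hγD ⟨t, ht, rfl⟩
  have hG : ContinuousOn (fun p : ℂ × ℝ => dslope f (γ p.2) p.1) (D ×ˢ Icc 0 1) :=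
    (continuousOn_dslope_prod hD hf).comp (f := fun p : ℂ × ℝ => (γ p.2, p.1))
      ((h.continuousOn.comp continuousOn_snd fun p hp => hp.2).prodMk continuousOn_fst)
      fun p hp => ⟨hγm _ hp.2, hp.1⟩
  exact (hasDerivAt_intervalIntegral_mul (G := fun w t => dslope f (γ t) w) hD hG
    (fun t ht => (Complex.differentiableOn_dslope (hD.mem_nhds (hγm t ht))).2 hf)
    h.intervalIntegrable_deriv hv).differentiableAt

theorem PiecewiseC1.contourIntegral_dslope (h : PiecewiseC1 γ) {f : ℂ → ℂ}
    (hf : ContinuousOn f (contourImage γ)) {v : ℂ} (hv : v ∉ contourImage γ) :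
    contourIntegral (fun z => dslope f z v) γ = contourIntegral (fun z => f z * (z - v)⁻¹) γ
      - 2 * Real.pi * Complex.I * (windingNumber γ v * f v) := by
  have hne : ∀ z ∈ contourImage γ, z - v ≠ 0 := fun z hz h0 => hv (sub_eq_zero.1 h0 ▸ hz)
  have hinv : ContinuousOn (fun z => (z - v)⁻¹) (contourImage γ) :=
    ContinuousOn.inv₀ (by fun_prop) hne
  have hpi : (2 * Real.pi * Complex.I : ℂ) ≠ 0 := Complex.two_pi_I_ne_zero
  have e : 2 * Real.pi * Complex.I * (windingNumber γ v * f v)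
      = ∫ t in (0 : ℝ)..1, f v * ((γ t - v)⁻¹ * deriv γ t) := by
    rw [intervalIntegral.integral_const_mul, windingNumber, contourIntegral, mul_comm _ (f v),
      mul_left_comm, mul_inv_cancel_left₀ hpi]
  have hi₁ : IntervalIntegrable (fun t => f (γ t) * (γ t - v)⁻¹ * deriv γ t) volume 0 1 :=
    h.contourIntegrable (hf.mul hinv)
  have hi₂ : IntervalIntegrable (fun t => f v * ((γ t - v)⁻¹ * deriv γ t)) volume 0 1 :=
    (h.contourIntegrable hinv).const_mul _
  rw [e, contourIntegral, contourIntegral, ← intervalIntegral.integral_sub hi₁ hi₂]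
  refine intervalIntegral.integral_congr (μ := volume) fun t ht => ?_
  rw [uIcc_of_le zero_le_one] at ht
  have hn := hne _ (mem_image_of_mem γ ht)
  have hn' : v ≠ γ t := fun h0 => hn (by rw [h0, sub_self])
  have hn'' : v - γ t ≠ 0 := sub_ne_zero.2 hn'
  simp only [dslope_of_ne f hn', slope_def_field]
  field_simp
  ring

/-- Cauchy's integral formula for a contour whose interior lies in the domain of holomorphy. -/
theorem PiecewiseC1.contourIntegral_mul_inv_sub (h : PiecewiseC1 γ) (hcl : γ 0 = γ 1) {D : Set ℂ}
    (hD : IsOpen D) (hγD : contourImage γ ⊆ D) (hint : contourInterior γ ⊆ D) {f : ℂ → ℂ}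
    (hf : DifferentiableOn ℂ f D) {w : ℂ} (hwD : w ∈ D) (hw : w ∉ contourImage γ) :
    contourIntegral (fun z => f z * (z - w)⁻¹) γ
      = 2 * Real.pi * Complex.I * (windingNumber γ w * f w) := by
  classical
  have hfc : ContinuousOn f (contourImage γ) := hf.continuousOn.mono hγD
  set F : ℂ → ℂ := fun v => if v ∈ D then contourIntegral (fun z => dslope f z v) γ
    else contourIntegral (fun z => f z * (z - v)⁻¹) γ with hF
  have hFeq : ∀ v, v ∉ contourImage γ → windingNumber γ v = 0 →
      F v = contourIntegral (fun z => f z * (z - v)⁻¹) γ := by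
    intro v hv h0
    simp only [hF]
    split_ifs
    · rw [h.contourIntegral_dslope hfc hv, h0, zero_mul, mul_zero, sub_zero]
    · rfl
  have hFd : Differentiable ℂ F := by
    intro v
    by_cases hv : v ∈ D
    · refine (h.differentiableAt_contourIntegral_dslope hD hγD hf hv).congr_of_eventuallyEq ?_
      filter_upwards [hD.mem_nhds hv] with x hx
      simp only [hF, if_pos hx]
    · have hvγ : v ∉ contourImage γ := fun hh => hv (hγD hh)
      have hv0 : windingNumber γ v = 0 := by
        by_contra h0
        exact hv (hint ⟨hvγ, h0⟩)
      obtain ⟨ε, hε, hball⟩ := Metric.isOpen_iff.1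
        h.isCompact_contourImage.isClosed.isOpen_compl v hvγ
      refine (h.hasDerivAt_cauchyTransform hfc hvγ).differentiableAt.congr_of_eventuallyEq ?_
      filter_upwards [Metric.ball_mem_nhds v hε] with x hx
      refine hFeq x (hball hx) ?_
      rw [h.windingNumber_eq_of_isPreconnected hcl Metric.isOpen_ball
        (convex_ball v ε).isPreconnected (disjoint_left.2 fun y hy => hball hy) hx
        (Metric.mem_ball_self hε), hv0]
  have hF0 : Tendsto F (cocompact ℂ) (𝓝 0) := by
    refine (h.tendsto_cauchyTransform_cocompact hfc).congr' ?_
    filter_upwards [h.eventually_windingNumber_eq_zero hcl] with v hv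
    exact (hFeq v hv.1 hv.2).symm
  have hzero := hFd.apply_eq_of_tendsto_cocompact w hF0
  simp only [hF, if_pos hwD, h.contourIntegral_dslope hfc hw] at hzero
  exact sub_eq_zero.1 hzero

end Contours

end HerglotzTrace

/-! ### Hilbert–Schmidt operators -/

namespace HerglotzTrace

section HilbertSchmidt

open Filter Topology
open scoped InnerProduct ENNReal

set_option linter.unusedSectionVars false

variable {ι κ : Type*} {E F G : Type*}
  [NormedAddCommGroup E] [InnerProductSpace ℂ E] [CompleteSpace E]
  [NormedAddCommGroup F] [InnerProductSpace ℂ F] [CompleteSpace F]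
  [NormedAddCommGroup G] [InnerProductSpace ℂ G] [CompleteSpace G]

theorem tsum_enorm_inner_sq (b : HilbertBasis ι ℂ E) (x : E) :
    ∑' i, ‖inner ℂ (b i) x‖ₑ ^ 2 = ‖x‖ₑ ^ 2 := by
  have h := b.hasSum_inner_mul_inner x x
  have h' : HasSum (fun i => ‖inner ℂ (b i) x‖ ^ 2) (‖x‖ ^ 2) := by
    have h1 := Complex.hasSum_re h
    rw [← inner_self_eq_norm_sq (𝕜 := ℂ)]
    convert! h1 using 1
    funext i
    rw [← inner_conj_symm x (b i), Complex.conj_mul', ← Complex.ofReal_pow, Complex.ofReal_re]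
  have e : ∀ r : ℝ, 0 ≤ r → ∀ y : ENNReal, y = ENNReal.ofReal r →
      y ^ 2 = ENNReal.ofReal (r ^ 2) := by
    intro r hr y hy
    rw [hy, ENNReal.ofReal_pow hr]
  rw [e _ (norm_nonneg x) _ (ofReal_norm x).symm, ← h'.tsum_eq,
    ENNReal.ofReal_tsum_of_nonneg (fun i => by positivity) h'.summable]
  exact tsum_congr fun i => e _ (norm_nonneg _) _ (ofReal_norm _).symm

/-- The square of the Hilbert–Schmidt norm of `T`, computed in the Hilbert basis `b`. -/
noncomputable def hsSq (b : HilbertBasis ι ℂ E) (T : E →L[ℂ] F) : ℝ≥0∞ :=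
  ∑' i, ‖T (b i)‖ₑ ^ 2

theorem hsSq_adjoint (b : HilbertBasis ι ℂ E) (c : HilbertBasis κ ℂ F) (T : E →L[ℂ] F) :
    hsSq c (T†) = hsSq b T := by
  simp only [hsSq]
  calc ∑' j, ‖(T†) (c j)‖ₑ ^ 2 = ∑' j, ∑' i, ‖inner ℂ (b i) ((T†) (c j))‖ₑ ^ 2 := by
        simp_rw [tsum_enorm_inner_sq b]
    _ = ∑' i, ∑' j, ‖inner ℂ (b i) ((T†) (c j))‖ₑ ^ 2 := ENNReal.tsum_comm
    _ = ∑' i, ∑' j, ‖inner ℂ (c j) (T (b i))‖ₑ ^ 2 := by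
        refine tsum_congr fun i => tsum_congr fun j => ?_
        rw [ContinuousLinearMap.adjoint_inner_right, ← inner_conj_symm, ← ofReal_norm,
          RCLike.norm_conj, ofReal_norm]
    _ = ∑' i, ‖T (b i)‖ₑ ^ 2 := by simp_rw [tsum_enorm_inner_sq c]

theorem hsSq_le_of_norm_le (b : HilbertBasis ι ℂ E) {S : E →L[ℂ] F} {T : E →L[ℂ] G}
    (h : ∀ x, ‖S x‖ ≤ ‖T x‖) : hsSq b S ≤ hsSq b T := by
  refine ENNReal.tsum_le_tsum fun i => ?_
  gcongr
  exact enorm_le_iff_norm_le.2 (h _)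

theorem hsSq_congr_norm (b : HilbertBasis ι ℂ E) {S : E →L[ℂ] F} {T : E →L[ℂ] G}
    (h : ∀ x, ‖S x‖ = ‖T x‖) : hsSq b S = hsSq b T :=
  le_antisymm (hsSq_le_of_norm_le b fun x => (h x).le) (hsSq_le_of_norm_le b fun x => (h x).ge)

theorem hsSq_smul (b : HilbertBasis ι ℂ E) (c : ℂ) (T : E →L[ℂ] F) :
    hsSq b (c • T) = ‖c‖ₑ ^ 2 * hsSq b T := by
  simp only [hsSq, ← ENNReal.tsum_mul_left, smul_apply, enorm_smul, mul_pow]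

theorem hsSq_add_le (b : HilbertBasis ι ℂ E) (S T : E →L[ℂ] F) :
    hsSq b (S + T) ≤ 2 * (hsSq b S + hsSq b T) := by
  simp only [hsSq, ← ENNReal.tsum_add, ← ENNReal.tsum_mul_left]
  refine ENNReal.tsum_le_tsum fun i => ?_
  rw [add_apply]
  calc ‖S (b i) + T (b i)‖ₑ ^ 2 ≤ (‖S (b i)‖ₑ + ‖T (b i)‖ₑ) ^ 2 := by
        gcongr; exact enorm_add_le _ _
    _ ≤ 2 * (‖S (b i)‖ₑ ^ 2 + ‖T (b i)‖ₑ ^ 2) := by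
        simp only [← ofReal_norm]
        rw [← ENNReal.ofReal_add (norm_nonneg _) (norm_nonneg _),
          ← ENNReal.ofReal_pow (by positivity),
          ← ENNReal.ofReal_pow (norm_nonneg _), ← ENNReal.ofReal_pow (norm_nonneg _),
          ← ENNReal.ofReal_add (by positivity) (by positivity), ← ENNReal.ofReal_ofNat 2,
          ← ENNReal.ofReal_mul (by norm_num)]
        exact ENNReal.ofReal_le_ofReal (by nlinarith [sq_nonneg (‖S (b i)‖ - ‖T (b i)‖)])

/-! ### Square roots of positive operators -/

theorem adjoint_sqrt (X : E →L[ℂ] E) : (CFC.sqrt X)† = CFC.sqrt X :=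
  (IsSelfAdjoint.of_nonneg (CFC.sqrt_nonneg X)).adjoint_eq

theorem inner_sqrt_left {X : E →L[ℂ] E} (hX : 0 ≤ X) (x y : E) :
    inner ℂ (CFC.sqrt X x) (CFC.sqrt X y) = inner ℂ x (X y) := by
  conv_rhs => rw [← CFC.sqrt_mul_sqrt_self X hX]
  rw [mul_apply_eq_comp, ← ContinuousLinearMap.adjoint_inner_left (CFC.sqrt X) (CFC.sqrt X y),
    adjoint_sqrt]

theorem norm_sqrt_apply_sq {X : E →L[ℂ] E} (hX : 0 ≤ X) (x : E) :
    ‖CFC.sqrt X x‖ ^ 2 = (inner ℂ x (X x)).re := by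
  rw [← inner_sqrt_left hX, ← inner_self_eq_norm_sq (𝕜 := ℂ)]
  rfl

theorem norm_sqrt_sqrt_apply {X : E →L[ℂ] E} (hX : 0 ≤ X) (x : E) :
    ‖CFC.sqrt X (CFC.sqrt X x)‖ = ‖X x‖ := by
  rw [← mul_apply_eq_comp, CFC.sqrt_mul_sqrt_self X hX]

theorem norm_sqrt_apply_le {X Y : E →L[ℂ] E} (hX : 0 ≤ X) (hXY : X ≤ Y) (x : E) :
    ‖CFC.sqrt X x‖ ≤ ‖CFC.sqrt Y x‖ := by
  refine le_of_sq_le_sq ?_ (norm_nonneg _)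
  rw [norm_sqrt_apply_sq hX, norm_sqrt_apply_sq (hX.trans hXY)]
  have h := ((ContinuousLinearMap.le_def X Y).1 hXY).re_inner_nonneg_right x
  simp only [sub_apply, inner_sub_right, map_sub, sub_nonneg] at h
  exact h

theorem hsSq_le_of_le (b : HilbertBasis ι ℂ E) {X Y : E →L[ℂ] E} (hX : 0 ≤ X) (hXY : X ≤ Y) :
    hsSq b X ≤ hsSq b Y := by
  have hY := hX.trans hXY
  calc hsSq b X = hsSq b (CFC.sqrt X ∘L CFC.sqrt X) :=
        hsSq_congr_norm b fun x => (norm_sqrt_sqrt_apply hX x).symm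
    _ ≤ hsSq b (CFC.sqrt Y ∘L CFC.sqrt X) :=
        hsSq_le_of_norm_le b fun x => norm_sqrt_apply_le hX hXY _
    _ = hsSq b (CFC.sqrt X ∘L CFC.sqrt Y) := by
        rw [← hsSq_adjoint b b, ContinuousLinearMap.adjoint_comp, adjoint_sqrt, adjoint_sqrt]
    _ ≤ hsSq b (CFC.sqrt Y ∘L CFC.sqrt Y) :=
        hsSq_le_of_norm_le b fun x => norm_sqrt_apply_le hX hXY _
    _ = hsSq b Y := hsSq_congr_norm b fun x => norm_sqrt_sqrt_apply hY x

theorem adjoint_comp_self_nonneg (A : E →L[ℂ] F) : 0 ≤ A† ∘L A :=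
  (ContinuousLinearMap.nonneg_iff_isPositive _).2
    (ContinuousLinearMap.isPositive_adjoint_comp_self A)

theorem norm_sqrt_adjoint_comp_self (A : E →L[ℂ] F) (x : E) :
    ‖CFC.sqrt (A† ∘L A) x‖ = ‖A x‖ := by
  refine (sq_eq_sq₀ (norm_nonneg _) (norm_nonneg _)).1 ?_
  rw [norm_sqrt_apply_sq (adjoint_comp_self_nonneg A), ContinuousLinearMap.comp_apply,
    ContinuousLinearMap.adjoint_inner_right, ← inner_self_eq_norm_sq (𝕜 := ℂ)]
  rfl

theorem hsSq_self_comp_adjoint (b : HilbertBasis ι ℂ E) (c : HilbertBasis κ ℂ F) (A : E →L[ℂ] F) :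
    hsSq c (A ∘L A†) = hsSq b (A† ∘L A) := by
  calc hsSq c (A ∘L A†) = hsSq c (CFC.sqrt (A† ∘L A) ∘L A†) :=
        hsSq_congr_norm c fun x => (norm_sqrt_adjoint_comp_self A _).symm
    _ = hsSq b (A ∘L CFC.sqrt (A† ∘L A)) := by
        rw [← hsSq_adjoint c b, ContinuousLinearMap.adjoint_comp, adjoint_sqrt,
          ContinuousLinearMap.adjoint_adjoint]
    _ = hsSq b (CFC.sqrt (A† ∘L A) ∘L CFC.sqrt (A† ∘L A)) :=
        hsSq_congr_norm b fun x => (norm_sqrt_adjoint_comp_self A _).symm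
    _ = hsSq b (A† ∘L A) :=
        hsSq_congr_norm b fun x => norm_sqrt_sqrt_apply (adjoint_comp_self_nonneg A) x

/-! ### Conjugation by an operator of class `B₄` -/

theorem conj_nonneg (A : E →L[ℂ] F) {X : E →L[ℂ] E} (hX : 0 ≤ X) : 0 ≤ A ∘L X ∘L A† :=
  (ContinuousLinearMap.nonneg_iff_isPositive _).2
    (((ContinuousLinearMap.nonneg_iff_isPositive _).1 hX).conj_adjoint A)

theorem hsSq_conj_le_of_nonneg (c : HilbertBasis κ ℂ F) (A : E →L[ℂ] F) {X : E →L[ℂ] E}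
    (hX : 0 ≤ X) : hsSq c (A ∘L X ∘L A†) ≤ ‖X‖ₑ ^ 2 * hsSq c (A ∘L A†) := by
  have h1 : A ∘L X ∘L A† ≤ (‖X‖ : ℂ) • (A ∘L A†) := by
    have h2 : X ≤ algebraMap ℝ (E →L[ℂ] E) ‖X‖ :=
      (IsSelfAdjoint.of_nonneg hX).le_algebraMap_norm_self
    have h3 := conj_nonneg A (sub_nonneg.2 h2)
    rw [← sub_nonneg]
    convert h3 using 1
    ext x
    simp [Algebra.algebraMap_eq_smul_one]
  calc hsSq c (A ∘L X ∘L A†) ≤ hsSq c ((‖X‖ : ℂ) • (A ∘L A†)) :=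
        hsSq_le_of_le c (conj_nonneg A hX) h1
    _ = ‖X‖ₑ ^ 2 * hsSq c (A ∘L A†) := by
        rw [hsSq_smul, ← ofReal_norm (‖X‖ : ℂ), Complex.norm_real, norm_norm, ofReal_norm]

theorem hsSq_conj_le (c : HilbertBasis κ ℂ F) (A : E →L[ℂ] F) (X : E →L[ℂ] E) :
    hsSq c (A ∘L X ∘L A†) ≤ 16 * ‖X‖ₑ ^ 2 * hsSq c (A ∘L A†) := by
  obtain ⟨x, hx0, hxn, hx⟩ := CStarAlgebra.exists_sum_four_nonneg X
  have key : ∀ i, ∀ z : ℂ, ‖z‖ = 1 →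
      hsSq c (z • (A ∘L x i ∘L A†)) ≤ ‖X‖ₑ ^ 2 * hsSq c (A ∘L A†) := by
    intro i z hz
    have hz' : ‖z‖ₑ = 1 := by rw [← ofReal_norm, hz, ENNReal.ofReal_one]
    rw [hsSq_smul, hz', one_pow, one_mul]
    refine (hsSq_conj_le_of_nonneg c A (hx0 i)).trans ?_
    gcongr
    exact enorm_le_iff_norm_le.2 (hxn i)
  have e : A ∘L X ∘L A† = ((1 : ℂ) • (A ∘L x 0 ∘L A†) + Complex.I • (A ∘L x 1 ∘L A†))
      + ((-1 : ℂ) • (A ∘L x 2 ∘L A†) + (-Complex.I) • (A ∘L x 3 ∘L A†)) := by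
    conv_lhs => rw [hx]
    ext v
    simp [Fin.sum_univ_four, Complex.I_pow_three]
    abel
  set M := ‖X‖ₑ ^ 2 * hsSq c (A ∘L A†)
  rw [e, mul_assoc]
  calc _ ≤ 2 * (2 * (M + M) + 2 * (M + M)) := by
        refine (hsSq_add_le c _ _).trans ?_
        gcongr
        · refine (hsSq_add_le c _ _).trans ?_
          gcongr
          · exact key 0 1 (by simp)
          · exact key 1 _ (by simp)
        · refine (hsSq_add_le c _ _).trans ?_
          gcongr
          · exact key 2 _ (by simp)
          · exact key 3 _ (by simp)
    _ = 16 * M := by ring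

theorem summable_of_hsSq_ne_top {b : HilbertBasis ι ℂ E} {T : E →L[ℂ] F} (h : hsSq b T ≠ ∞) :
    Summable fun i => ‖T (b i)‖ ^ 2 := by
  have := ENNReal.summable_toReal h
  simpa using this

theorem memℓp_of_hsSq_ne_top {b : HilbertBasis ι ℂ E} {T : E →L[ℂ] F} (h : hsSq b T ≠ ∞) :
    Memℓp (fun i => T (b i)) 2 := by
  rw [memℓp_gen_iff (by norm_num)]
  simpa using summable_of_hsSq_ne_top h

theorem norm_sq_lp_eq_hsSq {b : HilbertBasis ι ℂ E} {T : E →L[ℂ] F} {v : lp (fun _ : ι => F) 2}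
    (hv : ∀ i, v i = T (b i)) : ‖v‖ ^ 2 = (hsSq b T).toReal := by
  have := lp.norm_rpow_eq_tsum (p := 2) (by norm_num) v
  simp only [ENNReal.toReal_ofNat, Real.rpow_ofNat] at this
  rw [this, hsSq, ENNReal.tsum_toReal_eq (fun i => by finiteness)]
  simp [hv]

/-- The operators `A X A*`, as elements of the Hilbert space of Hilbert–Schmidt operators. -/
noncomputable def conjLp (c : HilbertBasis κ ℂ F) (A : E →L[ℂ] F) (hA : hsSq c (A ∘L A†) ≠ ∞) :
    (E →L[ℂ] E) →ₗ[ℂ] lp (fun _ : κ => F) 2 where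
  toFun X := ⟨fun i => (A ∘L X ∘L A†) (c i), memℓp_of_hsSq_ne_top (ne_top_of_le_ne_top
    (by finiteness) (hsSq_conj_le c A X))⟩
  map_add' X Y := by ext i; simp; rfl
  map_smul' z X := by ext i; simp

theorem conjLp_apply (c : HilbertBasis κ ℂ F) (A : E →L[ℂ] F) (hA : hsSq c (A ∘L A†) ≠ ∞)
    (X : E →L[ℂ] E) (i : κ) : conjLp c A hA X i = (A ∘L X ∘L A†) (c i) := rfl

theorem norm_conjLp_le (c : HilbertBasis κ ℂ F) (A : E →L[ℂ] F) (hA : hsSq c (A ∘L A†) ≠ ∞)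
    (X : E →L[ℂ] E) :
    ‖conjLp c A hA X‖ ≤ 4 * √(hsSq c (A ∘L A†)).toReal * ‖X‖ := by
  refine le_of_sq_le_sq ?_ (by positivity)
  rw [norm_sq_lp_eq_hsSq (conjLp_apply c A hA X), mul_pow, mul_pow, Real.sq_sqrt (by positivity)]
  have h := ENNReal.toReal_mono (by finiteness) (hsSq_conj_le c A X)
  refine h.trans (le_of_eq ?_)
  simp
  ring

end HilbertSchmidt

end HerglotzTrace

namespace HerglotzTrace

section Trace

open Filter Topology
open scoped InnerProduct ENNReal

set_option linter.unusedSectionVars false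

variable {ι κ : Type*} {E F G : Type*}
  [NormedAddCommGroup E] [InnerProductSpace ℂ E] [CompleteSpace E]
  [NormedAddCommGroup F] [InnerProductSpace ℂ F] [CompleteSpace F]
  [NormedAddCommGroup G] [InnerProductSpace ℂ G] [CompleteSpace G]

/-! ### Positivity of the Hilbert–Schmidt pairing -/

theorem summable_norm_inner_sq_of_hsSq_ne_top {b : HilbertBasis ι ℂ E} {T : E →L[ℂ] E}
    (h : hsSq b T ≠ ∞) : Summable fun p : ι × ι => ‖inner ℂ (b p.2) (T (b p.1))‖ ^ 2 := by
  have h' : ∑' p : ι × ι, ‖inner ℂ (b p.2) (T (b p.1))‖ₑ ^ 2 ≠ ∞ := by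
    rw [ENNReal.tsum_prod (f := fun i j => ‖inner ℂ (b j) (T (b i))‖ₑ ^ 2)]
    simpa only [tsum_enorm_inner_sq, hsSq] using h
  simpa using ENNReal.summable_toReal h'

/-- The compressions of two positive operators to finitely many basis vectors have a product of
nonnegative trace. -/
theorem sum_inner_mul_inner_nonneg (b : HilbertBasis ι ℂ E) {P Q : E →L[ℂ] E} (hP : 0 ≤ P)
    (hQ : 0 ≤ Q) (s : Finset ι) :
    0 ≤ ∑ p ∈ s ×ˢ s, inner ℂ (P (b p.1)) (b p.2) * inner ℂ (b p.2) (Q (b p.1)) := by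
  set q := CFC.sqrt P
  have hPq : ∀ x y, inner ℂ (P x) y = inner ℂ (q x) (q y) := fun x y => by
    rw [inner_sqrt_left hP, ← ContinuousLinearMap.adjoint_inner_right,
      (IsSelfAdjoint.of_nonneg hP).adjoint_eq]
  have hsum : HasSum (fun k => ∑ p ∈ s ×ˢ s,
      inner ℂ (q (b p.1)) (b k) * inner ℂ (b k) (q (b p.2)) * inner ℂ (b p.2) (Q (b p.1)))
      (∑ p ∈ s ×ˢ s, inner ℂ (P (b p.1)) (b p.2) * inner ℂ (b p.2) (Q (b p.1))) := by
    refine hasSum_sum fun p _ => ?_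
    rw [hPq]
    exact (b.hasSum_inner_mul_inner _ _).mul_right _
  refine hsum.nonneg fun k => ?_
  have hpos := ((ContinuousLinearMap.nonneg_iff_isPositive Q).1 hQ).inner_nonneg_right
    (∑ i ∈ s, inner ℂ (q (b i)) (b k) • b i)
  convert hpos using 1
  rw [map_sum, sum_inner, Finset.sum_product_right]
  refine Finset.sum_congr rfl fun j _ => ?_
  rw [inner_sum]
  refine Finset.sum_congr rfl fun i _ => ?_
  rw [map_smul, inner_smul_left, inner_smul_right, inner_conj_symm]
  ring

theorem inner_lp_nonneg {b : HilbertBasis ι ℂ E} {P Q : E →L[ℂ] E} (hP : 0 ≤ P)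
    (hQ : 0 ≤ Q) {u v : lp (fun _ : ι => E) 2} (hu : ∀ i, u i = P (b i)) (hv : ∀ i, v i = Q (b i))
    (hPb : hsSq b P ≠ ∞) (hQb : hsSq b Q ≠ ∞) : 0 ≤ inner ℂ u v := by
  have hs : Summable fun p : ι × ι =>
      inner ℂ (P (b p.1)) (b p.2) * inner ℂ (b p.2) (Q (b p.1)) := by
    refine Summable.of_norm_bounded ((summable_norm_inner_sq_of_hsSq_ne_top hPb).add
      (summable_norm_inner_sq_of_hsSq_ne_top hQb)) fun p => ?_
    rw [norm_mul, norm_inner_symm]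
    nlinarith [sq_nonneg (‖inner ℂ (b p.2) (P (b p.1))‖ - ‖inner ℂ (b p.2) (Q (b p.1))‖),
      sq_nonneg (‖inner ℂ (b p.2) (P (b p.1))‖), sq_nonneg (‖inner ℂ (b p.2) (Q (b p.1))‖)]
  have hfib := hs.hasSum.prod_fiberwise fun i => b.hasSum_inner_mul_inner (P (b i)) (Q (b i))
  have huv : HasSum (fun i => inner ℂ (P (b i)) (Q (b i))) (inner ℂ u v) := by
    have := lp.hasSum_inner (𝕜 := ℂ) u v
    simpa only [hu, hv] using this
  rw [huv.unique hfib]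
  have hlim := (hs.hasSum.comp tendsto_finsetProd_atTop).comp
    (tendsto_atTop_diagonal : Tendsto (fun s : Finset ι => (s, s)) atTop atTop)
  exact ge_of_tendsto' hlim fun s => sum_inner_mul_inner_nonneg b hP hQ s

/-! ### Schatten classes -/

theorem hsSq_ne_top_of_isSchatten_four {A : E →L[ℂ] F} (hA : IsSchatten 4 A)
    (c : HilbertBasis κ ℂ F) : hsSq c (A ∘L A†) ≠ ∞ := by
  rw [hsSq_self_comp_adjoint (onb E) c]
  have hpow : absPow 4 A = (A† ∘L A) * (A† ∘L A) := by
    have := CFC.rpow_natCast (A† ∘L A) 2 (adjoint_comp_self_nonneg A)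
    rw [absPow, ← sq, ← this]
    norm_num
  have e : ∀ x : E, (inner ℂ x (absPow 4 A x)).re = ‖(A† ∘L A) x‖ ^ 2 := by
    intro x
    rw [hpow, mul_apply_eq_comp, ← ContinuousLinearMap.adjoint_inner_left,
      (IsSelfAdjoint.of_nonneg (adjoint_comp_self_nonneg A)).adjoint_eq,
      ← inner_self_eq_norm_sq (𝕜 := ℂ)]
    rfl
  have hs : Summable fun i : basisIndex E => ‖(A† ∘L A) (onb E i)‖ ^ 2 := by
    simpa only [IsSchatten, e] using hA
  have := hs.tsum_ofReal_ne_top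
  simpa only [hsSq, ENNReal.ofReal_pow (norm_nonneg _), ofReal_norm] using this

theorem hsSq_comp_le (b : HilbertBasis ι ℂ E) (U : F →L[ℂ] G) (T : E →L[ℂ] F) (hU : ‖U‖ ≤ 1) :
    hsSq b (U ∘L T) ≤ hsSq b T :=
  hsSq_le_of_norm_le b fun x => by
    simpa using U.le_of_opNorm_le hU (T x)

/-- Approximate polar decomposition. -/
theorem exists_contraction_inner_absPow_le (T : E →L[ℂ] F) {ε : ℝ} (hε : 0 < ε) :
    ∃ U : E →L[ℂ] F, ‖U‖ ≤ 1 ∧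
      ∀ x, (inner ℂ x (absPow 1 T x)).re ≤ ε * ‖x‖ ^ 2 + (inner ℂ (U x) (T x)).re := by
  set S := absPow 1 T with hS
  have hSsq : S = CFC.sqrt (T† ∘L T) := by rw [CFC.sqrt_eq_rpow]; rfl
  have hS0 : 0 ≤ S := hSsq ▸ CFC.sqrt_nonneg _
  have hSsa : IsSelfAdjoint S := IsSelfAdjoint.of_nonneg hS0
  have hSn : ∀ x, ‖S x‖ = ‖T x‖ := fun x => by rw [hSsq, norm_sqrt_adjoint_comp_self]
  have hSS : S * S = T† ∘L T := by
    rw [hSsq, CFC.sqrt_mul_sqrt_self _ (adjoint_comp_self_nonneg T)]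
  have hsp : ∀ x ∈ spectrum ℝ S, 0 ≤ x := fun x hx => spectrum_nonneg_of_nonneg hS0 hx
  have hne : ∀ x ∈ spectrum ℝ S, x + ε ≠ 0 := fun x hx => by linarith [hsp x hx]
  have hfc : ContinuousOn (fun x : ℝ => (x + ε)⁻¹) (spectrum ℝ S) :=
    ContinuousOn.inv₀ (by fun_prop) hne
  set W := cfc (fun x : ℝ => (x + ε)⁻¹) S with hW
  have hWsa : IsSelfAdjoint W := cfc_predicate _ _
  have hSW : S * W = cfc (fun x : ℝ => x * (x + ε)⁻¹) S := by
    rw [cfc_mul (fun x : ℝ => x) (fun x : ℝ => (x + ε)⁻¹) S (by fun_prop) hfc, cfc_id' ℝ S]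
  have hWSS : W * (S * S) = cfc (fun x : ℝ => (x + ε)⁻¹ * (x * x)) S := by
    rw [cfc_mul (fun x : ℝ => (x + ε)⁻¹) (fun x : ℝ => x * x) S hfc (by fun_prop),
      cfc_mul (fun x : ℝ => x) (fun x : ℝ => x) S (by fun_prop) (by fun_prop), cfc_id' ℝ S]
  refine ⟨T ∘L W, ?_, fun x => ?_⟩
  · refine ContinuousLinearMap.opNorm_le_bound _ zero_le_one fun x => ?_
    rw [ContinuousLinearMap.comp_apply, ← hSn, ← mul_apply_eq_comp]
    refine ContinuousLinearMap.le_of_opNorm_le _ ?_ x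
    rw [hSW]
    refine norm_cfc_le zero_le_one fun y hy => ?_
    have h1 := hsp y hy
    rw [Real.norm_of_nonneg (by positivity), ← div_eq_mul_inv]
    exact div_le_one_of_le₀ (by linarith) (by linarith)
  · have h1 : inner ℂ ((T ∘L W) x) (T x) = inner ℂ x ((W * (S * S)) x) := by
      rw [ContinuousLinearMap.comp_apply, ← ContinuousLinearMap.adjoint_inner_right,
        ← ContinuousLinearMap.comp_apply, ← hSS, mul_apply_eq_comp W,
        ← ContinuousLinearMap.adjoint_inner_left W, hWsa.adjoint_eq]
    have h2 : S ≤ algebraMap ℝ (E →L[ℂ] E) ε + W * (S * S) := by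
      have e : algebraMap ℝ (E →L[ℂ] E) ε + W * (S * S)
          = cfc (fun x : ℝ => ε + (x + ε)⁻¹ * (x * x)) S := by
        rw [cfc_const_add ε (fun x : ℝ => (x + ε)⁻¹ * (x * x)) S (hfc.mul (by fun_prop)), hWSS]
      rw [e]
      conv_lhs => rw [← cfc_id' ℝ S]
      refine cfc_mono (fun y hy => ?_) (by fun_prop)
        (continuousOn_const.add (hfc.mul (by fun_prop)))
      have h3 := hsp y hy
      have h4 : 0 < y + ε := by linarith
      have e2 : ε + (y + ε)⁻¹ * (y * y) - y = ε ^ 2 / (y + ε) := by field_simp; ring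
      have : 0 ≤ ε ^ 2 / (y + ε) := by positivity
      linarith
    have h5 := ((ContinuousLinearMap.le_def _ _).1 h2).re_inner_nonneg_right x
    rw [h1]
    simp only [sub_apply, add_apply, inner_sub_right, inner_add_right, map_sub, map_add,
      Algebra.algebraMap_eq_smul_one, smul_apply, one_apply_eq_self, sub_nonneg] at h5
    refine h5.trans (le_of_eq ?_)
    congr 1
    rw [← Complex.coe_smul, inner_smul_right, inner_self_eq_norm_sq_to_K]
    simp [← Complex.ofReal_pow]

theorem isSchatten_one_comp {b : HilbertBasis κ ℂ F} {X : F →L[ℂ] E} {Y : E →L[ℂ] F}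
    (hX : hsSq b X ≠ ∞) (hY : hsSq (onb E) Y ≠ ∞) : IsSchatten 1 (X ∘L Y) := by
  set T := X ∘L Y with hT
  have h0 : 0 ≤ absPow 1 T := CFC.rpow_nonneg
  refine summable_of_sum_le
    (c := (hsSq b X).toReal + (hsSq (onb E) Y).toReal) (fun i =>
      ((ContinuousLinearMap.nonneg_iff_isPositive _).1 h0).re_inner_nonneg_right _) fun s => ?_
  refine le_of_forall_pos_le_add fun δ hδ => ?_
  obtain ⟨U, hU, hUx⟩ := exists_contraction_inner_absPow_le T
    (show 0 < δ / (s.card + 1) by positivity)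
  have hU' : ‖U†‖ ≤ 1 := by simpa using hU
  have hXU : hsSq (onb E) (X† ∘L U) ≤ hsSq b X := by
    have e : X† ∘L U = (U† ∘L X)† := by
      rw [ContinuousLinearMap.adjoint_comp, ContinuousLinearMap.adjoint_adjoint]
    rw [e, hsSq_adjoint b (onb E)]
    exact hsSq_comp_le b _ X hU'
  have hXUt : hsSq (onb E) (X† ∘L U) ≠ ∞ := ne_top_of_le_ne_top hX hXU
  have htoReal : ∀ {Z : E →L[ℂ] F}, hsSq (onb E) Z ≠ ∞ →
      ∑ i ∈ s, ‖Z (onb E i)‖ ^ 2 ≤ (hsSq (onb E) Z).toReal := by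
    intro Z hZ
    have e : (hsSq (onb E) Z).toReal = ∑' i, ‖Z (onb E i)‖ ^ 2 := by
      rw [hsSq, ENNReal.tsum_toReal_eq (fun i => by finiteness)]
      simp
    rw [e]
    exact (summable_of_hsSq_ne_top hZ).sum_le_tsum s fun i _ => by positivity
  have hterm : ∀ i : basisIndex E, (inner ℂ (onb E i) (absPow 1 T (onb E i))).re
      ≤ δ / (s.card + 1) + (‖(X† ∘L U) (onb E i)‖ ^ 2 + ‖Y (onb E i)‖ ^ 2) := by
    intro i
    refine (hUx _).trans ?_
    rw [(onb E).orthonormal.1 i, one_pow, mul_one, hT, ContinuousLinearMap.comp_apply,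
      ← ContinuousLinearMap.adjoint_inner_left, ContinuousLinearMap.comp_apply]
    gcongr
    refine ((Complex.re_le_norm _).trans (norm_inner_le_norm _ _)).trans ?_
    nlinarith [sq_nonneg (‖(X†) (U (onb E i))‖ - ‖Y (onb E i)‖),
      sq_nonneg ‖(X†) (U (onb E i))‖, sq_nonneg ‖Y (onb E i)‖]
  refine (Finset.sum_le_sum fun i _ => hterm i).trans ?_
  rw [Finset.sum_add_distrib, Finset.sum_add_distrib, Finset.sum_const, nsmul_eq_mul]
  have h1 : (s.card : ℝ) * (δ / (s.card + 1)) ≤ δ := by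
    rw [mul_div_assoc', div_le_iff₀ (by positivity)]
    nlinarith
  have h2 := htoReal hXUt
  have h3 := htoReal hY
  have h4 := ENNReal.toReal_mono hX hXU
  linarith

theorem trace_conj_comp_conj {K₁ K₂ : Type*}
    [NormedAddCommGroup K₁] [InnerProductSpace ℂ K₁] [CompleteSpace K₁]
    [NormedAddCommGroup K₂] [InnerProductSpace ℂ K₂] [CompleteSpace K₂]
    {A₁ : K₁ →L[ℂ] E} {A₂ : K₂ →L[ℂ] E}
    (hA₁ : hsSq (onb E) (A₁ ∘L A₁†) ≠ ∞) (hA₂ : hsSq (onb E) (A₂ ∘L A₂†) ≠ ∞)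
    (X₁ : K₁ →L[ℂ] K₁) (X₂ : K₂ →L[ℂ] K₂) :
    trace ((A₁ ∘L X₁ ∘L A₁†) ∘L (A₂ ∘L X₂ ∘L A₂†))
      = inner ℂ (conjLp (onb E) A₁ hA₁ (X₁†)) (conjLp (onb E) A₂ hA₂ X₂) := by
  rw [lp.inner_eq_tsum, trace]
  refine tsum_congr fun i => ?_
  rw [conjLp_apply, conjLp_apply, ContinuousLinearMap.comp_apply,
    ← ContinuousLinearMap.adjoint_inner_left]
  simp only [ContinuousLinearMap.adjoint_comp, ContinuousLinearMap.adjoint_adjoint,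
    ContinuousLinearMap.comp_assoc]

theorem inner_conjLp_nonneg {K₁ K₂ : Type*}
    [NormedAddCommGroup K₁] [InnerProductSpace ℂ K₁] [CompleteSpace K₁]
    [NormedAddCommGroup K₂] [InnerProductSpace ℂ K₂] [CompleteSpace K₂] (c : HilbertBasis κ ℂ E)
    {A₁ : K₁ →L[ℂ] E} {A₂ : K₂ →L[ℂ] E}
    (hA₁ : hsSq c (A₁ ∘L A₁†) ≠ ∞) (hA₂ : hsSq c (A₂ ∘L A₂†) ≠ ∞)
    {X₁ : K₁ →L[ℂ] K₁} {X₂ : K₂ →L[ℂ] K₂} (hX₁ : 0 ≤ X₁) (hX₂ : 0 ≤ X₂) :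
    0 ≤ inner ℂ (conjLp c A₁ hA₁ X₁) (conjLp c A₂ hA₂ X₂) :=
  inner_lp_nonneg (conj_nonneg A₁ hX₁) (conj_nonneg A₂ hX₂) (conjLp_apply c A₁ hA₁ X₁)
    (conjLp_apply c A₂ hA₂ X₂)
    (ne_top_of_le_ne_top (by finiteness) (hsSq_conj_le c A₁ X₁))
    (ne_top_of_le_ne_top (by finiteness) (hsSq_conj_le c A₂ X₂))

end Trace

end HerglotzTrace

/-! ### Resolvents of self-adjoint operators -/

namespace HerglotzTrace

section Resolvent

variable {E : Type*} [NormedAddCommGroup E] [InnerProductSpace ℂ E] {L : E →ₗ.[ℂ] E}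

theorem isResolventAt_resolventOp {z : ℂ} (hz : z ∉ spec L) :
    IsResolventAt L z (resolventOp L z) := by
  have h : ∃ R : E →L[ℂ] E, IsResolventAt L z R := not_not.1 hz
  rw [resolventOp, dif_pos h]
  exact h.choose_spec

/-- The first resolvent identity. -/
theorem IsResolventAt.mul_one_sub {z w : ℂ} {R S : E →L[ℂ] E} (hR : IsResolventAt L z R)
    (hS : IsResolventAt L w S) : S * (1 - (w - z) • R) = R := by
  ext x
  obtain ⟨hx, hxe⟩ := hR.1 x
  have h := hS.2 ⟨R x, hx⟩
  rw [sub_eq_iff_eq_add.1 hxe] at h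
  simp only [mul_apply_eq_comp, sub_apply, one_apply_eq_self, smul_apply]
  convert h using 2
  rw [sub_smul]
  abel

theorem IsResolventAt.one_sub_mul_one_sub {z w : ℂ} {R S : E →L[ℂ] E} (hR : IsResolventAt L z R)
    (hS : IsResolventAt L w S) : (1 - (w - z) • R) * (1 - (z - w) • S) = 1 := by
  have h := hS.mul_one_sub hR
  rw [sub_mul, one_mul, smul_mul_assoc, h, ← neg_sub w z, neg_smul]
  abel

theorem IsResolventAt.isSelfAdjoint [CompleteSpace E] (hL : IsSelfAdjoint L) {a : ℝ}
    {R : E →L[ℂ] E} (hR : IsResolventAt L a R) : IsSelfAdjoint R := by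
  have hsym := LinearPMap.adjoint_isFormalAdjoint hL.dense_domain
  rw [LinearPMap.isSelfAdjoint_def.1 hL] at hsym
  rw [ContinuousLinearMap.isSelfAdjoint_iff_isSymmetric]
  intro x y
  obtain ⟨hx, hxe⟩ := hR.1 x
  obtain ⟨hy, hye⟩ := hR.1 y
  have h := hsym ⟨R x, hx⟩ ⟨R y, hy⟩
  simp only [ContinuousLinearMap.coe_coe]
  calc inner ℂ (R x) y = inner ℂ (R x) (L ⟨R y, hy⟩ - (a : ℂ) • R y) := by rw [hye]
    _ = inner ℂ (L ⟨R x, hx⟩ - (a : ℂ) • R x) (R y) := by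
      rw [inner_sub_right, inner_sub_left, h, inner_smul_left, inner_smul_right,
        Complex.conj_ofReal]
    _ = inner ℂ x (R y) := by rw [hxe]

theorem IsResolventAt.add_inv_mem_spec {z r : ℂ} {R : E →L[ℂ] E} (hR : IsResolventAt L z R)
    (hr : r ∈ spectrum ℂ R) (h0 : r ≠ 0) : z + r⁻¹ ∈ spec L := by
  rintro ⟨S, hS⟩
  refine hr ?_
  have e : algebraMap ℂ (E →L[ℂ] E) r - R = r • (1 - r⁻¹ • R) := by
    rw [smul_sub, smul_smul, mul_inv_cancel₀ h0, one_smul, Algebra.algebraMap_eq_smul_one]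
  rw [spectrum.mem_resolventSet_iff, e]
  have h1 := hR.one_sub_mul_one_sub hS
  have h2 := hS.one_sub_mul_one_sub hR
  rw [add_sub_cancel_left] at h1 h2
  have hu : IsUnit (1 - r⁻¹ • R) := isUnit_iff_exists.2 ⟨_, h1, h2⟩
  exact hu.smul (Units.mk0 r h0)

/-- The resolvent at `w` as a function of the resolvent at `z`. -/
theorem IsResolventAt.cfcHom_eq [CompleteSpace E] {z w : ℂ} {R S : E →L[ℂ] E}
    (hR : IsResolventAt L z R) (hS : IsResolventAt L w S) (hn : IsStarNormal R)
    (g : C(spectrum ℂ R, ℂ)) (hg : ∀ r, g r * (1 - (w - z) * r) = r) : cfcHom hn g = S := by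
  have h1 : cfcHom hn g * (1 - (w - z) • R) = R := by
    have e : (1 - (w - z) • R) = cfcHom (R := ℂ) hn
        (1 - (w - z) • (ContinuousMap.id ℂ).restrict (spectrum ℂ R)) := by
      rw [map_sub, map_one, map_smul, cfcHom_id hn]
    rw [e, ← map_mul]
    conv_rhs => rw [← cfcHom_id (R := ℂ) hn]
    congr 1
    ext r
    simpa using hg r
  have h2 := hR.mul_one_sub hS
  have h3 := hR.one_sub_mul_one_sub hS
  calc cfcHom hn g = cfcHom hn g * ((1 - (w - z) • R) * (1 - (z - w) • S)) := by rw [h3, mul_one]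
    _ = S * ((1 - (w - z) • R) * (1 - (z - w) • S)) := by rw [← mul_assoc, ← mul_assoc, h1, h2]
    _ = S := by rw [h3, mul_one]

theorem specInf_le {z : ℂ} (hz : z ∈ spec L) : specInf L ≤ (z.re : EReal) :=
  iInf₂_le z hz

end Resolvent

/-! ### Positive bilinear forms on spaces of continuous functions -/

section PositiveForms

open MeasureTheory

variable {X Y : Type*} [TopologicalSpace X] [CompactSpace X] [T2Space X]
  [TopologicalSpace Y] [CompactSpace Y] [T2Space Y]

/-- A compact family of continuous functions is uniformly approximated by interpolation with a
partition of unity. -/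
theorem exists_interpolation {g : ℝ → C(X, ℂ)} (hg : Continuous g) {ε : ℝ} (hε : 0 < ε) :
    ∃ (n : ℕ) (x : Fin n → X) (χ : Fin n → C(X, ℂ)), (∀ i, 0 ≤ χ i) ∧
      ∀ t ∈ Set.Icc (0 : ℝ) 1, ‖g t - ∑ i, g t (x i) • χ i‖ ≤ ε := by
  let F : X → C(Set.Icc (0 : ℝ) 1, ℂ) := ContinuousMap.curry
    ⟨fun p : X × Set.Icc (0 : ℝ) 1 => g p.2 p.1, by fun_prop⟩
  have hF : Continuous F := ContinuousMap.continuous _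
  have hFa : ∀ y (t : Set.Icc (0 : ℝ) 1), F y t = g t y := fun y t => rfl
  obtain ⟨s, hs⟩ := CompactSpace.elim_nhds_subcover (fun x => F ⁻¹' Metric.ball (F x) ε)
    fun x => hF.continuousAt.preimage_mem_nhds (Metric.ball_mem_nhds _ hε)
  let x : Fin s.card → X := fun i => (s.equivFin.symm i : X)
  obtain ⟨χ, hsupp, hsum, hχ, -⟩ := exists_continuous_sum_one_of_isOpen_isCompact
    (s := fun i => F ⁻¹' Metric.ball (F (x i)) ε) (fun i => Metric.isOpen_ball.preimage hF)
    (isCompact_univ (X := X)) (by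
      rw [← Set.top_eq_univ, ← hs]
      refine Set.iUnion₂_subset fun y hy => ?_
      refine Set.subset_iUnion_of_subset (s.equivFin ⟨y, hy⟩) ?_
      simp [x])
  refine ⟨s.card, x, fun i => ⟨fun y => (χ i y : ℂ), by fun_prop⟩, fun i y => ?_, fun t ht => ?_⟩
  · exact Complex.zero_le_real.2 (hχ i y).1
  · rw [ContinuousMap.norm_le _ hε.le]
    intro y
    have h1 : ∑ i, (χ i y : ℂ) = 1 := by
      have := hsum (Set.mem_univ y)
      simp only [Finset.sum_apply, Pi.one_apply] at this
      exact_mod_cast this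
    have e : (g t - ∑ i, g t (x i) • (⟨fun y => (χ i y : ℂ), by fun_prop⟩ : C(X, ℂ))) y
        = ∑ i, (g t y - g t (x i)) * (χ i y : ℂ) := by
      simp only [sub_mul, Finset.sum_sub_distrib, ← Finset.mul_sum, h1]
      simp
    rw [e]
    calc ‖∑ i, (g t y - g t (x i)) * (χ i y : ℂ)‖ ≤ ∑ i, ε * χ i y := by
          refine norm_sum_le_of_le _ fun i _ => ?_
          rw [norm_mul, Complex.norm_real, Real.norm_of_nonneg (hχ i y).1]
          by_cases h0 : χ i y = 0
          · simp [h0]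
          · have hy : y ∈ F ⁻¹' Metric.ball (F (x i)) ε :=
              hsupp i (subset_tsupport _ h0)
            have h2 := (ContinuousMap.dist_apply_le_dist (⟨t, ht⟩ : Set.Icc (0 : ℝ) 1)).trans_lt
              (Metric.mem_ball.1 hy)
            rw [hFa, hFa, dist_eq_norm] at h2
            exact mul_le_mul_of_nonneg_right h2.le (hχ i y).1
      _ = ε := by
          rw [← Finset.mul_sum]
          have : ∑ i, χ i y = 1 := by exact_mod_cast h1
          rw [this, mul_one]

theorem integral_bilinear_nonneg (B : C(X, ℂ) →L[ℂ] C(Y, ℂ) →L[ℂ] ℂ)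
    (hB : ∀ f g, 0 ≤ f → 0 ≤ g → 0 ≤ B f g) {g₁ : ℝ → C(X, ℂ)} {g₂ : ℝ → C(Y, ℂ)}
    (hg₁ : Continuous g₁) (hg₂ : Continuous g₂) {k : ℝ → ℂ}
    (hk : IntervalIntegrable k volume 0 1) {c : ℂ}
    (h : ∀ x y, 0 ≤ c * ∫ t in (0 : ℝ)..1, g₁ t x * g₂ t y * k t) :
    0 ≤ c * ∫ t in (0 : ℝ)..1, B (g₁ t) (g₂ t) * k t := by
  have hint : ∀ {u : ℝ → ℂ}, Continuous u → IntervalIntegrable (fun t => u t * k t) volume 0 1 :=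
    fun hu => hk.continuousOn_mul hu.continuousOn
  obtain ⟨M₁, hM₁⟩ := (isCompact_Icc (a := (0 : ℝ)) (b := 1)).exists_bound_of_continuousOn
    hg₁.continuousOn
  obtain ⟨M₂, hM₂⟩ := (isCompact_Icc (a := (0 : ℝ)) (b := 1)).exists_bound_of_continuousOn
    hg₂.continuousOn
  have hM₁0 : 0 ≤ M₁ := (norm_nonneg _).trans (hM₁ 0 (by simp))
  have hM₂0 : 0 ≤ M₂ := (norm_nonneg _).trans (hM₂ 0 (by simp))
  set J := ∫ t in (0 : ℝ)..1, ‖k t‖ with hJ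
  have hJ0 : 0 ≤ J := intervalIntegral.integral_nonneg zero_le_one fun t _ => norm_nonneg _
  set N := ‖c‖ * (‖B‖ * (M₂ + (M₁ + 1)) * J) with hN
  have hN0 : 0 ≤ N := by positivity
  refine isClosed_Ici.closure_subset (Metric.mem_closure_iff.2 fun η hη => ?_ :
    _ ∈ closure (Set.Ici (0 : ℂ)))
  set ε := min 1 (η / (N + 1)) with hεd
  have hε : 0 < ε := lt_min one_pos (by positivity)
  have hε1 : ε ≤ 1 := min_le_left _ _
  have hNε : N * ε < η := by
    calc N * ε ≤ N * (η / (N + 1)) := by gcongr; exact min_le_right _ _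
      _ < η := by
        rw [mul_div_assoc', div_lt_iff₀ (by positivity)]
        nlinarith
  obtain ⟨n, x, χ, hχ, hxχ⟩ := exists_interpolation hg₁ hε
  obtain ⟨m, y, ψ, hψ, hyψ⟩ := exists_interpolation hg₂ hε
  set f₁ : ℝ → C(X, ℂ) := fun t => ∑ i, g₁ t (x i) • χ i with hf₁
  set f₂ : ℝ → C(Y, ℂ) := fun t => ∑ j, g₂ t (y j) • ψ j with hf₂
  have hf₁c : Continuous f₁ := by fun_prop
  have hf₂c : Continuous f₂ := by fun_prop
  refine ⟨c * ∫ t in (0 : ℝ)..1, B (f₁ t) (f₂ t) * k t, ?_, ?_⟩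
  · have e : c * ∫ t in (0 : ℝ)..1, B (f₁ t) (f₂ t) * k t
        = ∑ i, ∑ j, B (χ i) (ψ j) * (c * ∫ t in (0 : ℝ)..1, g₁ t (x i) * g₂ t (y j) * k t) := by
      have e1 : ∀ t, B (f₁ t) (f₂ t) * k t
          = ∑ i, ∑ j, B (χ i) (ψ j) * (g₁ t (x i) * g₂ t (y j) * k t) := by
        intro t
        simp only [hf₁, hf₂, map_sum, map_smul, sum_apply, smul_apply, Finset.sum_mul,
          Finset.mul_sum, smul_eq_mul]
        rw [Finset.sum_comm]
        refine Finset.sum_congr rfl fun i _ => Finset.sum_congr rfl fun j _ => ?_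
        ring
      have hi : ∀ i j, IntervalIntegrable
          (fun t => B (χ i) (ψ j) * (g₁ t (x i) * g₂ t (y j) * k t)) volume 0 1 := fun i j =>
        (hint (u := fun t => g₁ t (x i) * g₂ t (y j)) (by fun_prop)).const_mul _
      simp only [e1]
      have hi' : ∀ i, IntervalIntegrable
          (fun t => ∑ j, B (χ i) (ψ j) * (g₁ t (x i) * g₂ t (y j) * k t)) volume 0 1 := by
        intro i
        have := IntervalIntegrable.sum Finset.univ fun j _ => hi i j
        rwa [Finset.sum_fn] at this
      rw [intervalIntegral.integral_finsetSum fun i _ => hi' i, Finset.mul_sum]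
      refine Finset.sum_congr rfl fun i _ => ?_
      rw [intervalIntegral.integral_finsetSum fun j _ => hi i j, Finset.mul_sum]
      refine Finset.sum_congr rfl fun j _ => ?_
      rw [intervalIntegral.integral_const_mul]
      ring
    rw [Set.mem_Ici, e]
    exact Finset.sum_nonneg fun i _ => Finset.sum_nonneg fun j _ =>
      mul_nonneg (hB _ _ (hχ i) (hψ j)) (h _ _)
  · rw [dist_eq_norm, ← mul_sub, ← intervalIntegral.integral_sub
      (hint (u := fun t => B (g₁ t) (g₂ t)) (by fun_prop))
      (hint (u := fun t => B (f₁ t) (f₂ t)) (by fun_prop)), norm_mul]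
    refine lt_of_le_of_lt ?_ hNε
    have hest : ∀ t ∈ Set.Icc (0 : ℝ) 1,
        ‖B (g₁ t) (g₂ t) - B (f₁ t) (f₂ t)‖ ≤ ‖B‖ * (M₂ + (M₁ + 1)) * ε := by
      intro t ht
      have h1 := hxχ t ht
      have h2 := hyψ t ht
      have h3 : ‖f₁ t‖ ≤ M₁ + 1 := by
        have := norm_sub_norm_le (f₁ t) (g₁ t)
        rw [norm_sub_rev] at this
        linarith [hM₁ t ht]
      have e : B (g₁ t) (g₂ t) - B (f₁ t) (f₂ t)
          = B (g₁ t - f₁ t) (g₂ t) + B (f₁ t) (g₂ t - f₂ t) := by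
        simp
      rw [e]
      calc _ ≤ ‖B‖ * ‖g₁ t - f₁ t‖ * ‖g₂ t‖ + ‖B‖ * ‖f₁ t‖ * ‖g₂ t - f₂ t‖ :=
            norm_add_le_of_le (B.le_opNorm₂ _ _) (B.le_opNorm₂ _ _)
        _ ≤ ‖B‖ * ε * M₂ + ‖B‖ * (M₁ + 1) * ε := by
            gcongr
            exact hM₂ t ht
        _ = _ := by ring
    have hle : ‖∫ t in (0 : ℝ)..1, (B (g₁ t) (g₂ t) * k t - B (f₁ t) (f₂ t) * k t)‖
        ≤ ∫ t in (0 : ℝ)..1, ‖B‖ * (M₂ + (M₁ + 1)) * ε * ‖k t‖ := by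
      refine intervalIntegral.norm_integral_le_of_norm_le zero_le_one
        (Filter.Eventually.of_forall fun t ht => ?_) (hk.norm.const_mul _)
      rw [← sub_mul, norm_mul]
      exact mul_le_mul_of_nonneg_right (hest t (Set.Ioc_subset_Icc_self ht)) (norm_nonneg _)
    rw [intervalIntegral.integral_const_mul] at hle
    calc _ ≤ ‖c‖ * (‖B‖ * (M₂ + (M₁ + 1)) * ε * J) := by gcongr
      _ = N * ε := by rw [hN]; ring

end PositiveForms

end HerglotzTrace

namespace HerglotzTrace

/-! ### Positivity of the scalar contour integrals -/

section Kernel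

open Set

variable {γ : ℝ → ℂ}

theorem contourIntegral_congr {f g : ℂ → ℂ} (h : EqOn f g (contourImage γ)) :
    contourIntegral f γ = contourIntegral g γ := by
  refine intervalIntegral.integral_congr (μ := MeasureTheory.volume) fun t ht => ?_
  rw [uIcc_of_le zero_le_one] at ht
  simp only [h (mem_image_of_mem γ ht)]

theorem contourIntegral_const_mul (c : ℂ) (f : ℂ → ℂ) :
    contourIntegral (fun z => c * f z) γ = c * contourIntegral f γ := by
  simp only [contourIntegral, mul_assoc, intervalIntegral.integral_const_mul]

theorem ContourIntegrable.contourIntegral_add {f g : ℂ → ℂ} (hf : ContourIntegrable f γ)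
    (hg : ContourIntegrable g γ) :
    contourIntegral (fun z => f z + g z) γ = contourIntegral f γ + contourIntegral g γ := by
  simp only [contourIntegral, add_mul]
  exact intervalIntegral.integral_add hf hg

/-- The spectral points allowed by the geometry: inside `(a, b)`, or to the right of `b` and
outside the domain `D`. -/
def IsSpectralPoint (D : Set ℂ) (a b x : ℝ) : Prop :=
  x ∈ Ioo a b ∨ b < x ∧ (x : ℂ) ∉ D

variable {D : Set ℂ} {a b : ℝ} {φ : ℂ → ℂ}

theorem real_antitoneOn (hD : IsOpen D) (habD : Complex.ofReal '' Ioo a b ⊆ D)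
    (hφ : DifferentiableOn ℂ φ D) (hφ1 : ∀ x ∈ Ioo a b, deriv φ (x : ℂ) ≤ 0) :
    AntitoneOn (fun x : ℝ => (φ x).re) (Ioo a b) := by
  have hder : ∀ x ∈ Ioo a b,
      HasDerivAt (fun x : ℝ => (φ x).re) (deriv φ (x : ℂ)).re x := fun x hx =>
    (hφ.differentiableAt (hD.mem_nhds (habD (mem_image_of_mem _ hx)))).hasDerivAt.real_of_complex
  refine antitoneOn_of_deriv_nonpos (convex_Ioo a b)
    (fun x hx => (hder x hx).continuousAt.continuousWithinAt)
    (fun x hx => (hder x (interior_subset hx)).differentiableAt.differentiableWithinAt)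
    fun x hx => ?_
  rw [(hder x (interior_subset hx)).deriv]
  exact (Complex.le_def.1 (hφ1 x (interior_subset hx))).1

/-- The geometric situation: a closed contour in `D` that winds once clockwise around `[a, b]`. -/
structure IsEnclosing (γ : ℝ → ℂ) (D : Set ℂ) (a b : ℝ) : Prop where
  piecewiseC1 : PiecewiseC1 γ
  closed : γ 0 = γ 1
  isOpen : IsOpen D
  image_subset : contourImage γ ⊆ D
  interior_subset : contourInterior γ ⊆ D
  encircles : EncirclesClockwise γ (Complex.ofReal '' Icc a b)

namespace IsEnclosing

theorem notMem (h : IsEnclosing γ D a b) {x : ℝ} (hx : x ∈ Icc a b) :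
    (x : ℂ) ∉ contourImage γ := (h.encircles _ (mem_image_of_mem _ hx)).1

theorem ofReal_mem (h : IsEnclosing γ D a b) {x : ℝ} (hx : x ∈ Icc a b) : (x : ℂ) ∈ D := by
  refine h.interior_subset ⟨h.notMem hx, ?_⟩
  rw [(h.encircles _ (mem_image_of_mem _ hx)).2]
  simp

theorem sub_ne_zero_of_isSpectralPoint (h : IsEnclosing γ D a b) {x : ℝ}
    (hx : IsSpectralPoint D a b x) : ∀ z ∈ contourImage γ, z - x ≠ 0 := by
  intro z hz h0
  rw [sub_eq_zero.1 h0] at hz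
  rcases hx with hx | hx
  · exact h.notMem (Ioo_subset_Icc_self hx) hz
  · exact hx.2 (h.image_subset hz)

theorem contourIntegral_mul_inv_sub (h : IsEnclosing γ D a b) {f : ℂ → ℂ}
    (hf : DifferentiableOn ℂ f D) {x : ℝ} (hx : x ∈ Icc a b) :
    (2 * Real.pi * Complex.I)⁻¹ * contourIntegral (fun z => f z * (z - x)⁻¹) γ = -f x := by
  rw [h.piecewiseC1.contourIntegral_mul_inv_sub h.closed h.isOpen h.image_subset h.interior_subset
    hf (h.ofReal_mem hx) (h.notMem hx), inv_mul_cancel_left₀ Complex.two_pi_I_ne_zero,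
    (h.encircles _ (mem_image_of_mem _ hx)).2]
  ring

theorem contourIntegral_eq_zero (h : IsEnclosing γ D a b) (hab : a < b) {f : ℂ → ℂ}
    (hf : DifferentiableOn ℂ f D) :
    (2 * Real.pi * Complex.I)⁻¹ * contourIntegral f γ = 0 := by
  have ha : a ∈ Icc a b := left_mem_Icc.2 hab.le
  have key := h.contourIntegral_mul_inv_sub (f := fun z => f z * (z - a))
    (hf.mul (by fun_prop)) ha
  simp only [sub_self, mul_zero, neg_zero] at key
  rw [← key]
  congr 1
  refine contourIntegral_congr fun z hz => ?_
  have : z - a ≠ 0 := fun h0 => h.notMem ha (sub_eq_zero.1 h0 ▸ hz)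
  rw [mul_inv_cancel_right₀ this]

theorem continuousOn_inv_sub (h : IsEnclosing γ D a b) {x : ℝ} (hx : IsSpectralPoint D a b x) :
    ContinuousOn (fun z : ℂ => (z - x)⁻¹) (contourImage γ) :=
  ContinuousOn.inv₀ (by fun_prop) (h.sub_ne_zero_of_isSpectralPoint hx)

theorem kernel_inside_inside_of_ne (h : IsEnclosing γ D a b) (hφ : DifferentiableOn ℂ φ D)
    (hφ0 : ∀ x ∈ Ioo a b, 0 ≤ φ (x : ℂ)) (hφ1 : ∀ x ∈ Ioo a b, deriv φ (x : ℂ) ≤ 0)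
    {x y : ℝ} (hx : x ∈ Ioo a b) (hy : y ∈ Ioo a b) (hxy : x ≠ y) :
    0 ≤ (2 * Real.pi * Complex.I)⁻¹ *
      contourIntegral (fun z => φ z * ((z - x)⁻¹ * (z - y)⁻¹)) γ := by
  have hφc : ContinuousOn φ (contourImage γ) := hφ.continuousOn.mono h.image_subset
  have hne : (x : ℂ) - y ≠ 0 := sub_ne_zero.2 (by exact_mod_cast hxy)
  have e : contourIntegral (fun z => φ z * ((z - x)⁻¹ * (z - y)⁻¹)) γ
      = ((x : ℂ) - y)⁻¹ * contourIntegral (fun z => φ z * (z - x)⁻¹) γ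
        + (-((x : ℂ) - y)⁻¹) * contourIntegral (fun z => φ z * (z - y)⁻¹) γ := by
    rw [← contourIntegral_const_mul, ← contourIntegral_const_mul,
      ← ContourIntegrable.contourIntegral_add]
    · refine contourIntegral_congr fun z hz => ?_
      have h1 := h.sub_ne_zero_of_isSpectralPoint (Or.inl hx) z hz
      have h2 := h.sub_ne_zero_of_isSpectralPoint (Or.inl hy) z hz
      field_simp
      ring
    · exact h.piecewiseC1.contourIntegrable
        (continuousOn_const.mul (hφc.mul (h.continuousOn_inv_sub (Or.inl hx))))
    · exact h.piecewiseC1.contourIntegrable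
        (continuousOn_const.mul (hφc.mul (h.continuousOn_inv_sub (Or.inl hy))))
  have habD : Complex.ofReal '' Ioo a b ⊆ D := by
    rintro _ ⟨t, ht, rfl⟩
    exact h.ofReal_mem (Ioo_subset_Icc_self ht)
  have hanti := real_antitoneOn h.isOpen habD hφ hφ1
  have hre : ∀ t ∈ Ioo a b, φ t = ((φ t).re : ℂ) := fun t ht =>
    Complex.ext rfl (by simpa using (Complex.le_def.1 (hφ0 t ht)).2.symm)
  have hreal : 0 ≤ (x - y)⁻¹ * ((φ y).re - (φ x).re) := by
    rcases lt_or_gt_of_ne hxy with hlt | hlt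
    · exact mul_nonneg_of_nonpos_of_nonpos (inv_nonpos.2 (by linarith))
        (sub_nonpos.2 (hanti hx hy hlt.le))
    · exact mul_nonneg (inv_nonneg.2 (by linarith)) (sub_nonneg.2 (hanti hy hx hlt.le))
  have e2 : (2 * Real.pi * Complex.I)⁻¹ *
      contourIntegral (fun z => φ z * ((z - x)⁻¹ * (z - y)⁻¹)) γ
        = (((x - y)⁻¹ * ((φ y).re - (φ x).re) : ℝ) : ℂ) := by
    have h1 := h.contourIntegral_mul_inv_sub hφ (Ioo_subset_Icc_self hx)
    have h2 := h.contourIntegral_mul_inv_sub hφ (Ioo_subset_Icc_self hy)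
    rw [hre x hx] at h1
    rw [hre y hy] at h2
    rw [e, mul_add, mul_left_comm, h1, mul_left_comm, h2]
    push_cast
    ring
  rw [e2]
  exact Complex.zero_le_real.2 hreal

theorem kernel_inside_self (h : IsEnclosing γ D a b) (hφ : DifferentiableOn ℂ φ D)
    (hφ1 : ∀ x ∈ Ioo a b, deriv φ (x : ℂ) ≤ 0) {x : ℝ} (hx : x ∈ Ioo a b) :
    0 ≤ (2 * Real.pi * Complex.I)⁻¹ *
      contourIntegral (fun z => φ z * ((z - x)⁻¹ * (z - x)⁻¹)) γ := by
  have hxD := h.ofReal_mem (Ioo_subset_Icc_self hx)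
  have hinv := h.continuousOn_inv_sub (Or.inl hx)
  have hne := h.sub_ne_zero_of_isSpectralPoint (Or.inl hx)
  have hds : DifferentiableOn ℂ (dslope φ x) D :=
    (Complex.differentiableOn_dslope (h.isOpen.mem_nhds hxD)).2 hφ
  have hsq : contourIntegral (fun z => (z - x)⁻¹ * (z - x)⁻¹) γ = 0 := by
    refine h.piecewiseC1.contourIntegral_of_hasDerivAt h.closed (f := fun z => -(z - x)⁻¹)
      (fun z hz => ?_) (hinv.mul hinv)
    have := (((hasDerivAt_id z).sub_const (x : ℂ)).inv (hne z hz)).neg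
    have e : (z - x)⁻¹ * (z - x)⁻¹ = -(-1 / (id z - x) ^ 2) := by
      have := hne z hz
      simp only [id]
      field_simp
    rw [e]
    exact this
  have e : contourIntegral (fun z => φ z * ((z - x)⁻¹ * (z - x)⁻¹)) γ
      = contourIntegral (fun z => dslope φ x z * (z - x)⁻¹) γ
        + φ x * contourIntegral (fun z => (z - x)⁻¹ * (z - x)⁻¹) γ := by
    rw [← contourIntegral_const_mul, ← ContourIntegrable.contourIntegral_add]
    · refine contourIntegral_congr fun z hz => ?_
      have h1 := hne z hz
      simp only [dslope_of_ne φ (sub_ne_zero.1 h1), slope_def_field]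
      field_simp
      ring
    · exact h.piecewiseC1.contourIntegrable
        ((hds.continuousOn.mono h.image_subset).mul hinv)
    · exact h.piecewiseC1.contourIntegrable (continuousOn_const.mul (hinv.mul hinv))
  rw [e, hsq, mul_zero, add_zero, h.contourIntegral_mul_inv_sub hds (Ioo_subset_Icc_self hx),
    dslope_same]
  exact neg_nonneg.2 (hφ1 x hx)

theorem kernel_inside_outside (h : IsEnclosing γ D a b) (hφ : DifferentiableOn ℂ φ D)
    (hφ0 : ∀ x ∈ Ioo a b, 0 ≤ φ (x : ℂ)) {x y : ℝ} (hx : x ∈ Ioo a b) (hby : b < y)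
    (hyD : (y : ℂ) ∉ D) :
    0 ≤ (2 * Real.pi * Complex.I)⁻¹ *
      contourIntegral (fun z => φ z * ((z - x)⁻¹ * (z - y)⁻¹)) γ := by
  have hd : DifferentiableOn ℂ (fun z => φ z * (z - y)⁻¹) D :=
    hφ.mul (DifferentiableOn.inv (by fun_prop) fun z hz h0 => hyD (sub_eq_zero.1 h0 ▸ hz))
  have e : contourIntegral (fun z => φ z * ((z - x)⁻¹ * (z - y)⁻¹)) γ
      = contourIntegral (fun z => φ z * (z - y)⁻¹ * (z - x)⁻¹) γ :=
    contourIntegral_congr fun z _ => by ring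
  rw [e, h.contourIntegral_mul_inv_sub hd (Ioo_subset_Icc_self hx)]
  have e2 : -(φ x * ((x : ℂ) - y)⁻¹) = φ x * (((y - x)⁻¹ : ℝ) : ℂ) := by
    rw [← neg_sub (y : ℂ) x, inv_neg]
    push_cast
    ring
  rw [e2]
  exact mul_nonneg (hφ0 x hx) (Complex.zero_le_real.2 (inv_nonneg.2 (by linarith [hx.2])))

theorem kernel_nonneg (h : IsEnclosing γ D a b) (hab : a < b) (hφ : DifferentiableOn ℂ φ D)
    (hφ0 : ∀ x ∈ Ioo a b, 0 ≤ φ (x : ℂ)) (hφ1 : ∀ x ∈ Ioo a b, deriv φ (x : ℂ) ≤ 0)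
    {x y : ℝ} (hx : IsSpectralPoint D a b x) (hy : IsSpectralPoint D a b y) :
    0 ≤ (2 * Real.pi * Complex.I)⁻¹ *
      contourIntegral (fun z => φ z * ((z - x)⁻¹ * (z - y)⁻¹)) γ := by
  rcases hx with hx | ⟨hbx, hxD⟩ <;> rcases hy with hy | ⟨hby, hyD⟩
  · rcases eq_or_ne x y with rfl | hxy
    · exact h.kernel_inside_self hφ hφ1 hx
    · exact h.kernel_inside_inside_of_ne hφ hφ0 hφ1 hx hy hxy
  · exact h.kernel_inside_outside hφ hφ0 hx hby hyD
  · simp only [mul_comm (_ - (x : ℂ))⁻¹]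
    exact h.kernel_inside_outside hφ hφ0 hy hbx hxD
  · have hinv : ∀ {u : ℂ}, u ∉ D → DifferentiableOn ℂ (fun z => (z - u)⁻¹) D := fun hu =>
      DifferentiableOn.inv (by fun_prop) fun z hz h0 => hu (sub_eq_zero.1 h0 ▸ hz)
    exact (h.contourIntegral_eq_zero hab (hφ.mul ((hinv hxD).mul (hinv hyD)))).ge

end IsEnclosing

end Kernel

/-! ### The resolvent along the contour -/

section ResolventFamily

open Set

variable {E : Type*} [NormedAddCommGroup E] [InnerProductSpace ℂ E] [CompleteSpace E]
  {γ : ℝ → ℂ} {D : Set ℂ} {a b : ℝ}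

theorem IsEnclosing.exists_resolvent_family (h : IsEnclosing γ D a b)
    {L : E →ₗ.[ℂ] E} (hL : IsSelfAdjoint L) (hinf : (a : EReal) < specInf L)
    (hspec : spec L ∩ D ⊆ Complex.ofReal '' Ioo a b) :
    ∃ (R : E →L[ℂ] E) (hn : IsStarNormal R) (g : ℝ → C(spectrum ℂ R, ℂ)), Continuous g ∧
      (∀ t ∈ Icc (0 : ℝ) 1, cfcHom hn (g t) = resolventOp L (γ t)) ∧
      ∀ r, (∀ t ∈ Icc (0 : ℝ) 1, g t r = 0) ∨
        ∃ x : ℝ, IsSpectralPoint D a b x ∧ ∀ t ∈ Icc (0 : ℝ) 1, g t r = -(γ t - x)⁻¹ := by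
  have ha : (a : ℂ) ∉ spec L := fun ha => not_lt.2 (specInf_le ha) (by simpa using hinf)
  have hR := isResolventAt_resolventOp ha
  set R := resolventOp L a
  have hRsa : IsSelfAdjoint R := hR.isSelfAdjoint hL
  have hn : IsStarNormal R := hRsa.isStarNormal
  have hz : ∀ z ∈ contourImage γ, z ∉ spec L := by
    intro z hzγ hz
    obtain ⟨x, hx, rfl⟩ := hspec ⟨hz, h.image_subset hzγ⟩
    exact h.notMem (Ioo_subset_Icc_self hx) hzγ
  have hpt : ∀ r : spectrum ℂ R, (r : ℂ) ≠ 0 →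
      ∃ x : ℝ, IsSpectralPoint D a b x ∧ (r : ℂ)⁻¹ = x - a := by
    intro r hr
    have hmem := hR.add_inv_mem_spec r.2 hr
    have hre : (r : ℂ) = ((r : ℂ).re : ℂ) := hRsa.mem_spectrum_eq_re r.2
    have hx : (a : ℂ) + (r : ℂ)⁻¹ = ((a + (r : ℂ).re⁻¹ : ℝ) : ℂ) := by
      rw [hre]; push_cast; simp
    refine ⟨a + (r : ℂ).re⁻¹, ?_, by rw [← hx]; ring⟩
    rw [hx] at hmem
    set x : ℝ := a + (r : ℂ).re⁻¹
    by_cases hxD : (x : ℂ) ∈ D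
    · obtain ⟨y, hy, hyx⟩ := hspec ⟨hmem, hxD⟩
      rw [Complex.ofReal_inj.1 hyx] at hy
      exact Or.inl hy
    · refine Or.inr ⟨?_, hxD⟩
      by_contra! hxb
      have hax : a < x := by
        have := hinf.trans_le (specInf_le hmem)
        simpa using this
      exact hxD (h.ofReal_mem ⟨hax.le, hxb⟩)
  have hden : ∀ z ∈ contourImage γ, ∀ r : spectrum ℂ R, 1 - (z - a) * (r : ℂ) ≠ 0 := by
    intro z hzγ r h0
    rcases eq_or_ne (r : ℂ) 0 with hr | hr
    · simp [hr] at h0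
    · obtain ⟨x, hx, hxr⟩ := hpt r hr
      refine h.sub_ne_zero_of_isSpectralPoint hx z hzγ ?_
      have h1 : (z - a) = (r : ℂ)⁻¹ := by
        exact eq_inv_of_mul_eq_one_left (sub_eq_zero.1 h0).symm
      rw [hxr] at h1
      linear_combination h1
  set p : ℝ → ℂ := IccExtend (zero_le_one (α := ℝ)) ((Icc (0 : ℝ) 1).domRestrict γ) with hp
  have hpc : Continuous p := (continuousOn_iff_continuous_domRestrict.1
    h.piecewiseC1.continuousOn).Icc_extend'
  have hpγ : ∀ t ∈ Icc (0 : ℝ) 1, p t = γ t := fun t ht => by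
    rw [hp, IccExtend_of_mem _ _ ht]; rfl
  have hpm : ∀ t, p t ∈ contourImage γ := fun t => ⟨projIcc 0 1 zero_le_one t, Subtype.mem _, rfl⟩
  let g : C(ℝ, C(spectrum ℂ R, ℂ)) := ContinuousMap.curry
    ⟨fun q : ℝ × spectrum ℂ R => (q.2 : ℂ) / (1 - (p q.1 - a) * (q.2 : ℂ)),
      Continuous.div (by fun_prop) (by fun_prop) fun q => hden _ (hpm _) _⟩
  have hg : ∀ t r, g t r = (r : ℂ) / (1 - (p t - a) * (r : ℂ)) := fun t r => rfl
  refine ⟨R, hn, g, g.continuous, fun t ht => ?_, fun r => ?_⟩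
  · have htγ : γ t ∈ contourImage γ := mem_image_of_mem γ ht
    refine hR.cfcHom_eq (isResolventAt_resolventOp (hz _ htγ)) hn _ fun r => ?_
    rw [hg, hpγ t ht, div_mul_cancel₀ _ (hden _ htγ r)]
  · rcases eq_or_ne (r : ℂ) 0 with hr | hr
    · exact Or.inl fun t _ => by rw [hg, hr, zero_div]
    · obtain ⟨x, hx, hxr⟩ := hpt r hr
      refine Or.inr ⟨x, hx, fun t ht => ?_⟩
      have htγ : γ t ∈ contourImage γ := mem_image_of_mem γ ht
      have h1 := h.sub_ne_zero_of_isSpectralPoint hx _ htγ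
      rw [hg, hpγ t ht, div_eq_iff (hden _ htγ r)]
      have h2 : (r : ℂ) * (x - a) = 1 := by rw [← hxr, mul_inv_cancel₀ hr]
      field_simp
      linear_combination -h2

end ResolventFamily

/-! ### The trace as a positive bilinear form -/

section TraceForm

open scoped InnerProduct ENNReal

variable {H K₁ K₂ : Type*}
  [NormedAddCommGroup H] [InnerProductSpace ℂ H] [CompleteSpace H]
  [NormedAddCommGroup K₁] [InnerProductSpace ℂ K₁] [CompleteSpace K₁]
  [NormedAddCommGroup K₂] [InnerProductSpace ℂ K₂] [CompleteSpace K₂]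

theorem exists_traceForm {A₁ : K₁ →L[ℂ] H} {A₂ : K₂ →L[ℂ] H}
    (hA₁ : hsSq (onb H) (A₁ ∘L A₁†) ≠ ∞) (hA₂ : hsSq (onb H) (A₂ ∘L A₂†) ≠ ∞)
    {R₁ : K₁ →L[ℂ] K₁} {R₂ : K₂ →L[ℂ] K₂} (hR₁ : IsStarNormal R₁) (hR₂ : IsStarNormal R₂) :
    ∃ B : C(spectrum ℂ R₁, ℂ) →L[ℂ] C(spectrum ℂ R₂, ℂ) →L[ℂ] ℂ,
      (∀ f g, B f g = trace ((A₁ ∘L cfcHom hR₁ f ∘L A₁†) ∘L (A₂ ∘L cfcHom hR₂ g ∘L A₂†))) ∧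
      ∀ f g, 0 ≤ f → 0 ≤ g → 0 ≤ B f g := by
  set Φ₁ := conjLp (onb H) A₁ hA₁
  set Φ₂ := conjLp (onb H) A₂ hA₂
  set C₁ := 4 * √(hsSq (onb H) (A₁ ∘L A₁†)).toReal
  set C₂ := 4 * √(hsSq (onb H) (A₂ ∘L A₂†)).toReal
  let B₀ : C(spectrum ℂ R₁, ℂ) →ₗ[ℂ] C(spectrum ℂ R₂, ℂ) →ₗ[ℂ] ℂ := LinearMap.mk₂ ℂ
    (fun f g => inner ℂ (Φ₁ ((cfcHom hR₁ f)†)) (Φ₂ (cfcHom hR₂ g)))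
    (fun f f' g => by rw [map_add, map_add, map_add, inner_add_left])
    (fun c f g => by
      rw [map_smul, LinearIsometryEquiv.map_smulₛₗ, map_smul, inner_smul_left, Complex.conj_conj,
        smul_eq_mul])
    (fun f g g' => by rw [map_add, map_add, inner_add_right])
    (fun c f g => by rw [map_smul, map_smul, inner_smul_right, smul_eq_mul])
  have hbound : ∀ f g, ‖B₀ f g‖ ≤ C₁ * C₂ * ‖f‖ * ‖g‖ := by
    intro f g
    have h1 : ‖Φ₁ ((cfcHom hR₁ f)†)‖ ≤ C₁ * ‖f‖ := by
      refine (norm_conjLp_le (onb H) A₁ hA₁ _).trans ?_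
      rw [LinearIsometryEquiv.norm_map, norm_cfcHom R₁ f hR₁]
    have h2 : ‖Φ₂ (cfcHom hR₂ g)‖ ≤ C₂ * ‖g‖ := by
      refine (norm_conjLp_le (onb H) A₂ hA₂ _).trans ?_
      rw [norm_cfcHom R₂ g hR₂]
    calc ‖B₀ f g‖ ≤ ‖Φ₁ ((cfcHom hR₁ f)†)‖ * ‖Φ₂ (cfcHom hR₂ g)‖ :=
          norm_inner_le_norm (𝕜 := ℂ) (Φ₁ ((cfcHom hR₁ f)†)) (Φ₂ (cfcHom hR₂ g))
      _ ≤ (C₁ * ‖f‖) * (C₂ * ‖g‖) := by gcongr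
      _ = C₁ * C₂ * ‖f‖ * ‖g‖ := by ring
  refine ⟨B₀.mkContinuous₂ _ hbound, fun f g => ?_, fun f g hf hg => ?_⟩
  · rw [LinearMap.mkContinuous₂_apply, trace_conj_comp_conj hA₁ hA₂]
    rfl
  · rw [LinearMap.mkContinuous₂_apply]
    have h1 : 0 ≤ cfcHom hR₁ f := (cfcHom_nonneg_iff hR₁).2 hf
    have h2 : 0 ≤ cfcHom hR₂ g := (cfcHom_nonneg_iff hR₂).2 hg
    have h3 : (cfcHom hR₁ f)† = cfcHom hR₁ f := (IsSelfAdjoint.of_nonneg h1).adjoint_eq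
    change 0 ≤ inner ℂ (Φ₁ ((cfcHom hR₁ f)†)) (Φ₂ (cfcHom hR₂ g))
    rw [h3]
    exact inner_conjLp_nonneg (onb H) hA₁ hA₂ h1 h2

end TraceForm

end HerglotzTrace

theorem theorem2p3
    {H K₁ K₂ : Type*}
    [NormedAddCommGroup H] [InnerProductSpace ℂ H] [CompleteSpace H]
    [NormedAddCommGroup K₁] [InnerProductSpace ℂ K₁] [CompleteSpace K₁]
    [NormedAddCommGroup K₂] [InnerProductSpace ℂ K₂] [CompleteSpace K₂]
    (L₁ : K₁ →ₗ.[ℂ] K₁) (L₂ : K₂ →ₗ.[ℂ] K₂)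
    (hL₁ : IsSelfAdjoint L₁) (hL₂ : IsSelfAdjoint L₂)
    (hb₁ : HerglotzTrace.BoundedFromBelow L₁) (hb₂ : HerglotzTrace.BoundedFromBelow L₂)
    (A₁ : K₁ →L[ℂ] H) (A₂ : K₂ →L[ℂ] H)
    (hA₁ : HerglotzTrace.IsSchatten 4 A₁) (hA₂ : HerglotzTrace.IsSchatten 4 A₂)
    (D : Set ℂ) (hDo : IsOpen D) (hDc : IsConnected D)
    (a b : ℝ) (hab : a < b)
    (hinf : (a : EReal) < min (HerglotzTrace.specInf L₁) (HerglotzTrace.specInf L₂))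
    (hspec : (HerglotzTrace.spec L₁ ∪ HerglotzTrace.spec L₂) ∩ D ⊆
      Complex.ofReal '' Set.Ioo a b)
    (habD : Complex.ofReal '' Set.Ioo a b ⊆ D)
    (γ : ℝ → ℂ) (hγ : HerglotzTrace.IsJordanContour γ)
    (hγD : HerglotzTrace.contourImage γ ⊆ D)
    (hγint : HerglotzTrace.contourInterior γ ⊆ D)
    (hγab : HerglotzTrace.EncirclesClockwise γ (Complex.ofReal '' Set.Icc a b))
    (φ : ℂ → ℂ) (hφ : AnalyticOnNhd ℂ φ D)
    (hφ0 : ∀ x ∈ Set.Ioo a b, 0 ≤ φ (x : ℂ))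
    (hφ1 : ∀ x ∈ Set.Ioo a b, deriv φ (x : ℂ) ≤ 0) :
    (∀ z ∈ HerglotzTrace.contourImage γ,
      HerglotzTrace.IsSchatten 1
        (HerglotzTrace.herglotz A₁ L₁ z ∘L HerglotzTrace.herglotz A₂ L₂ z)) ∧
    HerglotzTrace.ContourIntegrable (fun z => φ z * HerglotzTrace.trace
      (HerglotzTrace.herglotz A₁ L₁ z ∘L HerglotzTrace.herglotz A₂ L₂ z)) γ ∧
    0 ≤ (2 * Real.pi * Complex.I)⁻¹ * HerglotzTrace.contourIntegral
      (fun z => φ z * HerglotzTrace.trace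
        (HerglotzTrace.herglotz A₁ L₁ z ∘L HerglotzTrace.herglotz A₂ L₂ z)) γ := by

  have henc : HerglotzTrace.IsEnclosing γ D a b :=
    ⟨hγ.piecewiseC1, hγ.closed, hDo, hγD, hγint, hγab⟩
  have hφd : DifferentiableOn ℂ φ D := hφ.differentiableOn
  have hS₁ := HerglotzTrace.hsSq_ne_top_of_isSchatten_four hA₁ (HerglotzTrace.onb H)
  have hS₂ := HerglotzTrace.hsSq_ne_top_of_isSchatten_four hA₂ (HerglotzTrace.onb H)
  obtain ⟨R₁, hR₁, g₁, hg₁, hg₁R, hg₁v⟩ := henc.exists_resolvent_family hL₁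
    (hinf.trans_le (min_le_left _ _)) fun z hz => hspec ⟨Or.inl hz.1, hz.2⟩
  obtain ⟨R₂, hR₂, g₂, hg₂, hg₂R, hg₂v⟩ := henc.exists_resolvent_family hL₂
    (hinf.trans_le (min_le_right _ _)) fun z hz => hspec ⟨Or.inr hz.1, hz.2⟩
  obtain ⟨B, hB, hBpos⟩ := HerglotzTrace.exists_traceForm hS₁ hS₂ hR₁ hR₂
  have hBt : ∀ t ∈ Set.Icc (0 : ℝ) 1, HerglotzTrace.trace
      (HerglotzTrace.herglotz A₁ L₁ (γ t) ∘L HerglotzTrace.herglotz A₂ L₂ (γ t))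
        = B (g₁ t) (g₂ t) := by
    intro t ht
    rw [hB, hg₁R t ht, hg₂R t ht]
    rfl
  set k : ℝ → ℂ := fun t => φ (γ t) * deriv γ t with hk
  have hkint : IntervalIntegrable k MeasureTheory.volume 0 1 :=
    hγ.piecewiseC1.contourIntegrable (hφd.continuousOn.mono hγD)
  have hBk : IntervalIntegrable (fun t => B (g₁ t) (g₂ t) * k t) MeasureTheory.volume 0 1 :=
    hkint.continuousOn_mul (by fun_prop)
  have hEq : ∀ t ∈ Set.Icc (0 : ℝ) 1, B (g₁ t) (g₂ t) * k t = φ (γ t) * HerglotzTrace.trace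
      (HerglotzTrace.herglotz A₁ L₁ (γ t) ∘L HerglotzTrace.herglotz A₂ L₂ (γ t)) * deriv γ t := by
    intro t ht
    rw [hBt t ht, hk]
    ring
  refine ⟨fun z _ => ?_, ?_, ?_⟩
  · exact HerglotzTrace.isSchatten_one_comp (b := HerglotzTrace.onb H)
      (ne_top_of_le_ne_top (by finiteness) (HerglotzTrace.hsSq_conj_le _ A₁ _))
      (ne_top_of_le_ne_top (by finiteness) (HerglotzTrace.hsSq_conj_le _ A₂ _))
  · refine IntervalIntegrable.congr (fun t ht => ?_) hBk
    rw [Set.uIoc_of_le zero_le_one] at ht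
    exact hEq t (Set.Ioc_subset_Icc_self ht)
  · have hI : HerglotzTrace.contourIntegral (fun z => φ z * HerglotzTrace.trace
        (HerglotzTrace.herglotz A₁ L₁ z ∘L HerglotzTrace.herglotz A₂ L₂ z)) γ
          = ∫ t in (0 : ℝ)..1, B (g₁ t) (g₂ t) * k t := by
      refine intervalIntegral.integral_congr (μ := MeasureTheory.volume) fun t ht => ?_
      rw [Set.uIcc_of_le zero_le_one] at ht
      exact (hEq t ht).symm
    rw [hI]
    refine HerglotzTrace.integral_bilinear_nonneg B hBpos hg₁ hg₂ hkint fun x y => ?_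
    have hzero : (∀ t ∈ Set.Icc (0 : ℝ) 1, g₁ t x * g₂ t y = 0) →
        0 ≤ (2 * Real.pi * Complex.I)⁻¹ * ∫ t in (0 : ℝ)..1, g₁ t x * g₂ t y * k t := by
      intro h0
      rw [intervalIntegral.integral_congr (μ := MeasureTheory.volume) (g := fun _ => 0)
        fun t ht => ?_]
      · simp
      · rw [Set.uIcc_of_le zero_le_one] at ht
        simp only [h0 t ht, zero_mul]
    rcases hg₁v x with hx | ⟨u, hu, hxu⟩
    · exact hzero fun t ht => by rw [hx t ht, zero_mul]
    rcases hg₂v y with hy | ⟨v, hv, hyv⟩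
    · exact hzero fun t ht => by rw [hy t ht, mul_zero]
    convert henc.kernel_nonneg hab hφd hφ0 hφ1 hu hv using 2
    refine intervalIntegral.integral_congr (μ := MeasureTheory.volume) fun t ht => ?_
    rw [Set.uIcc_of_le zero_le_one] at ht
    simp only [hxu t ht, hyv t ht, hk]
    ring
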